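/- Let $E=(0,\infty)$, let $\mathcal M_+$ be the set of positive Radon measures on $E$, and write $m_1(\nu)=\int_E x\,\nu(dx)\in[0,\infty]$. Let $\mathcal E_1$ be the set of continuously differentiable $f:E\to\mathbb R$ such that $f$ and $f'$ have finite limits at $0$ and at $\infty$, $\lim_{x\to0}f(x)=0$, and $|f'(x)|\le Ce^{-\alpha x}$ for all $x>0$, for some constants $C$ and $\alpha>0$ depending on $f$. For $f\in\mathcal E_1$ and $\nu\in\mathcal M_+$ with $m_1(\nu)<\infty$ put $$\langle f,L(\nu)\rangle=\frac12\int_E\int_E\bigl[f(x+y)-f(x)-f(y)\bigr](x+y)\,\nu(dx)\,\nu(dy).$$ A map $t\mapsto\nu_t$ from $[0,\infty)$ to $\mathcal M_+$ is called a *solution* of Smoluchowski's coagulation equation with kernel $K(x,y)=x+y$ if 1. $m_1(\nu_0)<\infty$; 2. for every compact $B\subset E$ the map $t\mapsto\nu_t(B)$ is measurable; 3. $\int_0^t m_1(\nu_\tau)^2\,d\tau<\infty$ for all $t>0$; 4. for all $f\in\mathcal E_1$ and all $t\ge0$, $f$ is $\nu_t$-integrable, $\tau\mapsto\langle f,L(\nu_\tau)\rangle$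 (defined for almost every $\tau$ by 3) is integrable on $[0,t]$, and $$\int_E f\,d\nu_t=\int_E f\,d\nu_0+\int_0^t\langle f,L(\nu_\tau)\rangle\,d\tau .$$ **Theorem.** Let $\hat\nu\in\mathcal M_+$ satisfy $m_1(\hat\nu)<\infty$. Then there is a solution $(\nu_t)_{t\ge0}$ of Smoluchowski's coagulation equation with kernel $K=x+y$ with $\nu_0=\hat\nu$, it satisfies $m_1(\nu_t)=m_1(\hat\nu)$ for all $t\in[0,\infty)$, and it is unique: every solution $(\nu'_t)_{t\ge0}$ with $\nu'_0=\hat\nu$ satisfies $\nu'_t=\nu_t$ for all $t\ge0$. -/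

import Mathlib

open MeasureTheory Filter Topology Set

namespace Smoluchowski

/-- The open half-line `E = (0,∞)` of cluster sizes, with its subspace topology and Borel sets.
A measure on `E` is a positive Radon measure exactly when it is finite on compact subsets of `E`. -/
abbrev E : Type := Set.Ioi (0 : ℝ)

/-- The first moment (total mass) `∫_E x ν(dx) ∈ [0,∞]`. -/
noncomputable def firstMoment (ν : Measure E) : ENNReal :=
  ∫⁻ x : E, ENNReal.ofReal (x : ℝ) ∂ν

/-- The restriction of `f` to `(0,∞)` is of class `C^k([0,∞])`: it is `k` times continuously
differentiable on `(0,∞)`, and `f, f', …, f^(k)` have finite limits at `0` and at `∞`.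
Values of `f` outside `(0,∞)` play no role. -/
def IsCkBar (k : ℕ) (f : ℝ → ℝ) : Prop :=
  ContDiffOn ℝ k f (Ioi 0) ∧
    ∀ j ≤ k, (∃ l : ℝ, Tendsto (iteratedDeriv j f) (𝓝[>] 0) (𝓝 l)) ∧
      ∃ l : ℝ, Tendsto (iteratedDeriv j f) atTop (𝓝 l)

/-- The class `𝓔_k` of test functions: `f ∈ C^k([0,∞])`, the derivatives of orders `1, …, k` decay
exponentially, and the derivatives of orders `0, …, k - 1` vanish at zero. -/
def IsTestFunction (k : ℕ) (f : ℝ → ℝ) : Prop :=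
  IsCkBar k f ∧
    (∃ C α : ℝ, 0 < α ∧ ∀ x : ℝ, 0 < x →
      ∑ j ∈ Finset.Icc 1 k, |iteratedDeriv j f x| ≤ C * Real.exp (-α * x)) ∧
    ∀ j < k, Tendsto (iteratedDeriv j f) (𝓝[>] 0) (𝓝 0)

/-- The pairing
`⟨f, L(ν)⟩ = ½ ∫_E ∫_E (f(x+y) - f(x) - f(y)) K(x,y) ν(dx) ν(dy)`. -/
noncomputable def coagPairing (K : ℝ → ℝ → ℝ) (f : ℝ → ℝ) (ν : Measure E) : ℝ :=
  (1 / 2) * ∫ p : E × E,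
    (f ((p.1 : ℝ) + (p.2 : ℝ)) - f p.1 - f p.2) * K p.1 p.2 ∂(ν.prod ν)

/-- The additive kernel `K(x,y) = x + y`. -/
def additiveKernel (x y : ℝ) : ℝ := x + y

/-- `t ↦ ν t`, `0 ≤ t < ∞`, is a (weak) solution of Smoluchowski's coagulation equation with the
additive kernel `K(x,y) = x + y`. Values of `ν` at negative times play no role.
For `f ∈ 𝓔_1` the double integral in `⟨f, L(ν τ)⟩` converges absolutely as soon as `ν τ` has
finite first moment, which by `sq_mass` is the case for almost every `τ`. -/
structure IsAdditiveSolution (ν : ℝ → Measure E) : Prop where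
  /-- each `ν t` is a Radon measure on `(0,∞)` -/
  radon : ∀ t, 0 ≤ t → IsFiniteMeasureOnCompacts (ν t)
  /-- the initial mass is finite -/
  initial_mass : firstMoment (ν 0) < ⊤
  /-- `t ↦ ν t B` is measurable on `[0,∞)` for every compact `B ⊆ (0,∞)` -/
  measurable : ∀ B : Set E, IsCompact B → Measurable fun t : Ici (0 : ℝ) => ν t B
  /-- the mass is locally square integrable in time -/
  sq_mass : ∀ t, 0 < t → ∫⁻ τ in Ioc 0 t, firstMoment (ν τ) ^ 2 < ⊤
  /-- the pairings of `f` with `ν t` are finite for every test function `f` -/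
  integrable : ∀ f, IsTestFunction 1 f → ∀ t, 0 ≤ t → Integrable (fun x : E => f x) (ν t)
  /-- the time integral in the weak equation converges -/
  intervalIntegrable : ∀ f, IsTestFunction 1 f → ∀ t, 0 ≤ t →
    IntervalIntegrable (fun τ => coagPairing additiveKernel f (ν τ)) volume 0 t
  /-- the weak form of the equation -/
  weak_eq : ∀ f, IsTestFunction 1 f → ∀ t, 0 ≤ t →
    ∫ x : E, f x ∂(ν t) =
      (∫ x : E, f x ∂(ν 0)) + ∫ τ in (0 : ℝ)..t, coagPairing additiveKernel f (ν τ)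

end Smoluchowski

/-! Testing the equation with `1 - e^{-sx}` closes it. The bracket factorizes as `-(1 - e^{-sx})(1 -
e^{-sy})`, so the Laplace exponent `φ_t(s) = ∫ (1 - e^{-sx}) ν_t(dx)` solves the damped Burgers
equation `∂ₜφ = -φ (m - ∂ₛφ)`, where `m` is the mass. Along characteristics `φ` decays like
`e^{-mt}`, which gives `φ_t(s) = e^{-mt} φ_0(v)` with `v = s + θ(t) φ_0(v)` and `θ(t) = ∫_0^t
e^{-mτ} dτ`. Since `φ_0` is `m`-Lipschitz and `θ(t) m = 1 - e^{-mt} < 1`, the equation for `v` is a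
contraction at every time and no shock forms.

Existence requires that this explicit function be the exponent of a measure. The root `v` is a limit
of iterates built from sums, nonnegative multiples and compositions with `φ_0`, all of which
preserve the Bernstein property (`isBernsteinExponent_charRoot`). A Bernstein function vanishing at
zero and without drift comes from a measure (`IsBernsteinExponent.exists_measure`, through the Riesz
extension and Riesz–Markov theorems on `[0,1]`). The weak equation then holds for exponential sums,
and extends to all test functions because these are approximated with uniformly close derivatives,
while integrals and pairings are bounded by the Lipschitz constant times `m` and `m²`
(`IsTestFunction.exists_expSum`, `isTestFunction_weak_eq`).

For uniqueness, an arbitrary solution conserves mass (`IsAdditiveSolution.firstMoment_eq`), which is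
where square integrability of the mass in time enters. A Gronwall argument along characteristics
then forces its exponent to be the explicit one (`IsAdditiveSolution.laplaceExponent_eq`), and
exponents determine measures (`ext_of_laplaceExponent_eq`). -/

namespace Smoluchowski

/-! ### The Laplace exponent of a measure with finite first moment -/

/-- The Laplace exponent `∫ (1 - e^{-sx}) ν(dx)`. -/
noncomputable def laplaceExponent (ν : Measure E) (s : ℝ) : ℝ :=
  ∫ x : E, (1 - Real.exp (-(s * x))) ∂ν

/-- The Laplace transform `∫ x e^{-sx} ν(dx)` of the mass measure. -/
noncomputable def massTransform (ν : Measure E) (s : ℝ) : ℝ :=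
  ∫ x : E, (x : ℝ) * Real.exp (-(s * x)) ∂ν

/-- The first moment as a real number. -/
noncomputable def mass (ν : Measure E) : ℝ := ∫ x : E, (x : ℝ) ∂ν

lemma one_sub_exp_neg_le (y : ℝ) : 1 - Real.exp (-y) ≤ y := by
  linarith [Real.add_one_le_exp (-y)]

lemma one_sub_exp_neg_nonneg {y : ℝ} (hy : 0 ≤ y) : 0 ≤ 1 - Real.exp (-y) := by
  have : Real.exp (-y) ≤ 1 := Real.exp_le_one_iff.2 (by linarith)
  linarith

lemma mass_nonneg (ν : Measure E) : 0 ≤ mass ν :=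
  integral_nonneg fun x => x.2.le

section

variable {ν : Measure E}

lemma integrable_coe_iff : Integrable (fun x : E => (x : ℝ)) ν ↔ firstMoment ν < ⊤ := by
  rw [← lintegral_ofReal_ne_top_iff_integrable (by fun_prop)
    (ae_of_all _ fun x : E => x.2.le), ← lt_top_iff_ne_top]
  rfl

lemma firstMoment_eq_ofReal_mass (h : firstMoment ν < ⊤) :
    firstMoment ν = ENNReal.ofReal (mass ν) :=
  (ofReal_integral_eq_lintegral_ofReal (integrable_coe_iff.2 h)
    (ae_of_all _ fun x : E => x.2.le)).symm

lemma integrable_one_sub_exp (h : firstMoment ν < ⊤) {s : ℝ} (hs : 0 ≤ s) :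
    Integrable (fun x : E => 1 - Real.exp (-(s * x))) ν := by
  refine ((integrable_coe_iff.2 h).const_mul s).mono' (by fun_prop) (ae_of_all _ fun x => ?_)
  have hx : 0 ≤ s * (x : ℝ) := mul_nonneg hs x.2.le
  rw [Real.norm_of_nonneg (one_sub_exp_neg_nonneg hx)]
  exact one_sub_exp_neg_le _

lemma integrable_mul_exp (h : firstMoment ν < ⊤) {s : ℝ} (hs : 0 ≤ s) :
    Integrable (fun x : E => (x : ℝ) * Real.exp (-(s * x))) ν := by
  refine (integrable_coe_iff.2 h).mono' (by fun_prop) (ae_of_all _ fun x => ?_)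
  have hx : 0 ≤ s * (x : ℝ) := mul_nonneg hs x.2.le
  have hx' : (0 : ℝ) < x := x.2
  rw [Real.norm_of_nonneg (by positivity)]
  exact mul_le_of_le_one_right hx'.le (Real.exp_le_one_iff.2 (by linarith))

lemma laplaceExponent_zero (ν : Measure E) : laplaceExponent ν 0 = 0 := by
  simp [laplaceExponent]

lemma laplaceExponent_nonneg {s : ℝ} (hs : 0 ≤ s) : 0 ≤ laplaceExponent ν s :=
  integral_nonneg fun x => one_sub_exp_neg_nonneg (mul_nonneg hs x.2.le)

lemma laplaceExponent_mono (h : firstMoment ν < ⊤) {s t : ℝ} (hs : 0 ≤ s) (hst : s ≤ t) :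
    laplaceExponent ν s ≤ laplaceExponent ν t := by
  refine integral_mono (integrable_one_sub_exp h hs) (integrable_one_sub_exp h (hs.trans hst))
    fun x => ?_
  have : s * (x : ℝ) ≤ t * x := mul_le_mul_of_nonneg_right hst x.2.le
  have := Real.exp_le_exp.2 (neg_le_neg this)
  simp only
  linarith

lemma massTransform_nonneg (s : ℝ) : 0 ≤ massTransform ν s :=
  integral_nonneg fun x => mul_nonneg x.2.le (Real.exp_pos _).le

lemma massTransform_le_mass (h : firstMoment ν < ⊤) {s : ℝ} (hs : 0 ≤ s) :
    massTransform ν s ≤ mass ν :=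
  integral_mono (integrable_mul_exp h hs) (integrable_coe_iff.2 h) fun x =>
    mul_le_of_le_one_right x.2.le
      (Real.exp_le_one_iff.2 (by linarith [mul_nonneg hs (le_of_lt x.2)]))

/-- Concavity: the tangent at the left endpoint lies above the graph. Keeping its slope, rather than
bounding it by the mass, later shows that increments vanish at infinity. -/
lemma laplaceExponent_sub_le_massTransform (h : firstMoment ν < ⊤) {s t : ℝ} (hs : 0 ≤ s)
    (hst : s ≤ t) :
    laplaceExponent ν t - laplaceExponent ν s ≤ massTransform ν s * (t - s) := by
  rw [laplaceExponent, laplaceExponent,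
    ← integral_sub (integrable_one_sub_exp h (hs.trans hst)) (integrable_one_sub_exp h hs),
    massTransform, ← integral_mul_const]
  refine integral_mono ((integrable_one_sub_exp h (hs.trans hst)).sub
    (integrable_one_sub_exp h hs)) ((integrable_mul_exp h hs).mul_const _) fun x => ?_
  have h1 : Real.exp (-(t * (x : ℝ))) = Real.exp (-(s * x)) * Real.exp (-((t - s) * x)) := by
    rw [← Real.exp_add]; congr 1; ring
  calc 1 - Real.exp (-(t * (x : ℝ))) - (1 - Real.exp (-(s * x)))
      = Real.exp (-(s * x)) * (1 - Real.exp (-((t - s) * x))) := by rw [h1]; ring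
    _ ≤ Real.exp (-(s * x)) * ((t - s) * x) :=
      mul_le_mul_of_nonneg_left (one_sub_exp_neg_le _) (Real.exp_pos _).le
    _ = x * Real.exp (-(s * x)) * (t - s) := by ring

lemma laplaceExponent_sub_le (h : firstMoment ν < ⊤) {s t : ℝ} (hs : 0 ≤ s) (hst : s ≤ t) :
    laplaceExponent ν t - laplaceExponent ν s ≤ mass ν * (t - s) :=
  (laplaceExponent_sub_le_massTransform h hs hst).trans
    (mul_le_mul_of_nonneg_right (massTransform_le_mass h hs) (sub_nonneg.2 hst))

/-- Concavity again, with the tangent at `s` followed back to the origin; pointwise it is `1 + y ≤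
e^y` divided by `e^y`. -/
lemma massTransform_mul_le (h : firstMoment ν < ⊤) {s : ℝ} (hs : 0 ≤ s) :
    massTransform ν s * s ≤ laplaceExponent ν s := by
  rw [massTransform, ← integral_mul_const]
  refine integral_mono ((integrable_mul_exp h hs).mul_const _) (integrable_one_sub_exp h hs)
    fun x => ?_
  have h1 := mul_le_mul_of_nonneg_right (Real.add_one_le_exp (s * (x : ℝ)))
    (Real.exp_pos (-(s * (x : ℝ)))).le
  rw [← Real.exp_add, add_neg_cancel, Real.exp_zero] at h1
  simp only
  linarith

lemma laplaceExponent_le (h : firstMoment ν < ⊤) {s : ℝ} (hs : 0 ≤ s) :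
    laplaceExponent ν s ≤ mass ν * s := by
  simpa [laplaceExponent_zero] using laplaceExponent_sub_le h le_rfl hs

lemma abs_laplaceExponent_sub_le (h : firstMoment ν < ⊤) {s t : ℝ} (hs : 0 ≤ s) (ht : 0 ≤ t) :
    |laplaceExponent ν t - laplaceExponent ν s| ≤ mass ν * |t - s| := by
  rcases le_total s t with hst | hst
  · rw [abs_of_nonneg (sub_nonneg.2 (laplaceExponent_mono h hs hst)),
      abs_of_nonneg (sub_nonneg.2 hst)]
    exact laplaceExponent_sub_le h hs hst
  · rw [abs_sub_comm, abs_sub_comm t, abs_of_nonneg (sub_nonneg.2 (laplaceExponent_mono h ht hst)),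
      abs_of_nonneg (sub_nonneg.2 hst)]
    exact laplaceExponent_sub_le h ht hst

lemma lipschitzOnWith_laplaceExponent (h : firstMoment ν < ⊤) :
    LipschitzOnWith (mass ν).toNNReal (laplaceExponent ν) (Ici 0) :=
  LipschitzOnWith.of_dist_le_mul fun s hs t ht => by
    rw [Real.dist_eq, Real.dist_eq, Real.coe_toNNReal _ (mass_nonneg ν)]
    exact abs_laplaceExponent_sub_le h ht hs

lemma continuousOn_laplaceExponent (h : firstMoment ν < ⊤) :
    ContinuousOn (laplaceExponent ν) (Ici 0) :=
  (lipschitzOnWith_laplaceExponent h).continuousOn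

lemma hasDerivAt_laplaceExponent (h : firstMoment ν < ⊤) {s : ℝ} (hs : 0 < s) :
    HasDerivAt (laplaceExponent ν) (massTransform ν s) s := by
  refine (hasDerivAt_integral_of_dominated_loc_of_deriv_le (Ioi_mem_nhds hs)
    (F := fun s (x : E) => 1 - Real.exp (-(s * x)))
    (F' := fun s (x : E) => (x : ℝ) * Real.exp (-(s * x)))
    (bound := fun x : E => (x : ℝ)) (Eventually.of_forall fun s => by fun_prop)
    (integrable_one_sub_exp h hs.le) (by fun_prop) (ae_of_all _ fun x t ht => ?_)
    (integrable_coe_iff.2 h) (ae_of_all _ fun x t ht => ?_)).2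
  · have hx : (0 : ℝ) < x := x.2
    have ht : 0 < t := ht
    rw [Real.norm_of_nonneg (by positivity)]
    exact mul_le_of_le_one_right hx.le
      (Real.exp_le_one_iff.2 (by linarith [mul_pos ht hx]))
  · have h1 : HasDerivAt (fun t : ℝ => -(t * (x : ℝ))) (-(1 * (x : ℝ))) t :=
      ((hasDerivAt_id t).mul_const _).neg
    convert (h1.exp.const_sub 1) using 1
    ring

/-- The second moment may be infinite, but `r x e^{-sx} ≤ 1` for `s ≥ r` trades one factor `x` for
`1/r`. The constant depends on the measure only through its mass, hence is uniform in time once mass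
is conserved. -/
lemma abs_massTransform_sub_le (h : firstMoment ν < ⊤) {r s t : ℝ} (hr : 0 < r) (hs : r ≤ s)
    (ht : r ≤ t) : |massTransform ν t - massTransform ν s| ≤ mass ν / r * |t - s| := by
  wlog hst : s ≤ t generalizing s t
  · rw [abs_sub_comm, abs_sub_comm t]
    exact this ht hs (le_of_not_ge hst)
  have hs0 := hr.le.trans hs
  have ht0 := hr.le.trans ht
  rw [massTransform, massTransform, ← integral_sub (integrable_mul_exp h ht0)
    (integrable_mul_exp h hs0), div_mul_eq_mul_div, mul_div_assoc, mass, ← integral_mul_const]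
  refine abs_integral_le_integral_abs.trans (integral_mono ((integrable_mul_exp h ht0).sub
    (integrable_mul_exp h hs0)).abs ((integrable_coe_iff.2 h).mul_const _) fun x => ?_)
  have hx : (0 : ℝ) < x := x.2
  have h1 : Real.exp (-(t * (x : ℝ))) = Real.exp (-(s * x)) * Real.exp (-((t - s) * x)) := by
    rw [← Real.exp_add]; congr 1; ring
  have h3 := one_sub_exp_neg_le ((t - s) * (x : ℝ))
  have h4 := one_sub_exp_neg_nonneg (mul_nonneg (sub_nonneg.2 hst) hx.le)
  have h5 : r * x * Real.exp (-(s * x)) ≤ 1 := by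
    rw [Real.exp_neg, ← div_eq_mul_inv, div_le_one (Real.exp_pos _)]
    have := Real.add_one_le_exp (s * (x : ℝ))
    have := mul_le_mul_of_nonneg_right hs hx.le
    linarith
  simp only [← mul_sub, abs_mul, abs_of_pos hx]
  refine mul_le_mul_of_nonneg_left ?_ hx.le
  rw [h1, abs_of_nonneg (sub_nonneg.2 hst), le_div_iff₀ hr, abs_sub_comm, abs_of_nonneg
    (by nlinarith [Real.exp_pos (-(s * (x : ℝ)))])]
  calc (Real.exp (-(s * (x : ℝ))) - Real.exp (-(s * x)) * Real.exp (-((t - s) * x))) * r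
      = r * Real.exp (-(s * x)) * (1 - Real.exp (-((t - s) * x))) := by ring
    _ ≤ r * Real.exp (-(s * x)) * ((t - s) * x) := by gcongr
    _ = (r * x * Real.exp (-(s * x))) * (t - s) := by ring
    _ ≤ 1 * (t - s) := mul_le_mul_of_nonneg_right h5 (sub_nonneg.2 hst)
    _ = t - s := one_mul _

/-- `(1 - e^{-sx}) / s` increases to `x` as `s` decreases to zero, so that the first moment can be
read off from the Laplace exponent. -/
lemma tendsto_ofReal_mul_laplaceExponent
    (h : ∀ s, 0 < s → Integrable (fun x : E => 1 - Real.exp (-(s * x))) ν) :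
    Tendsto (fun n : ℕ => ENNReal.ofReal ((n + 1 : ℝ) * laplaceExponent ν (1 / (n + 1 : ℝ))))
      atTop (𝓝 (firstMoment ν)) := by
  have key : ∀ n : ℕ, ENNReal.ofReal ((n + 1 : ℝ) * laplaceExponent ν (1 / (n + 1 : ℝ))) =
      ∫⁻ x : E, ENNReal.ofReal ((n + 1 : ℝ) * (1 - Real.exp (-(1 / (n + 1 : ℝ) * x)))) ∂ν := by
    intro n
    rw [laplaceExponent, ← integral_const_mul]
    refine ofReal_integral_eq_lintegral_ofReal ((h _ (by positivity)).const_mul _)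
      (ae_of_all _ fun x => ?_)
    have hx : (0 : ℝ) < x := x.2
    exact mul_nonneg (by positivity) (one_sub_exp_neg_nonneg (by positivity))
  simp_rw [key]
  -- Monotone convergence is valid with an infinite limit, so the result can be used to prove that a
  -- first moment is finite.
  refine lintegral_tendsto_of_tendsto_of_monotone (fun n => by fun_prop)
    (ae_of_all _ fun x => ?_) (ae_of_all _ fun x => ?_)
  · have hx : (0 : ℝ) < x := x.2
    refine fun n k hnk => ENNReal.ofReal_le_ofReal ?_
    have hnk' : (n + 1 : ℝ) ≤ k + 1 := by exact_mod_cast Nat.succ_le_succ hnk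
    have hw : (n + 1 : ℝ) / (k + 1) ≤ 1 := (div_le_one (by positivity)).2 hnk'
    -- Convexity of `exp` at `-x/(k+1)`, which lies between `-x/(n+1)` and `0` with weight
    -- `(n+1)/(k+1)` on the former.
    have hc := convexOn_exp.2 (mem_univ (-(1 / (n + 1 : ℝ) * x))) (mem_univ 0)
      (show (0 : ℝ) ≤ (n + 1 : ℝ) / (k + 1) by positivity) (sub_nonneg.2 hw) (by ring)
    have he : ((n + 1 : ℝ) / (k + 1)) • (-(1 / (n + 1 : ℝ) * x)) +
        (1 - (n + 1 : ℝ) / (k + 1)) • (0 : ℝ) = -(1 / (k + 1 : ℝ) * x) := by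
      simp only [smul_eq_mul]; field_simp; ring
    rw [he] at hc
    simp only [smul_eq_mul, Real.exp_zero] at hc
    have hc' := mul_le_mul_of_nonneg_left hc (show (0 : ℝ) ≤ k + 1 by positivity)
    have e1 : (k + 1 : ℝ) * ((n + 1 : ℝ) / (k + 1) * Real.exp (-(1 / (n + 1 : ℝ) * x)) +
        (1 - (n + 1 : ℝ) / (k + 1)) * 1) =
        (n + 1 : ℝ) * Real.exp (-(1 / (n + 1 : ℝ) * x)) + ((k + 1) - (n + 1)) := by
      field_simp
    rw [e1] at hc'
    linarith
  · refine (ENNReal.continuous_ofReal.tendsto _).comp ?_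
    have h1 : HasDerivAt (fun t : ℝ => -(t * (x : ℝ))) (-(1 * (x : ℝ))) 0 :=
      ((hasDerivAt_id _).mul_const _).neg
    have h2 := (h1.exp.const_sub 1)
    have h3 := h2.tendsto_slope_zero_right
    have h4 : Tendsto (fun n : ℕ => 1 / (n + 1 : ℝ)) atTop (𝓝[>] 0) :=
      tendsto_nhdsWithin_iff.2 ⟨tendsto_one_div_add_atTop_nhds_zero_nat,
        Eventually.of_forall fun n => mem_Ioi.2 (by positivity)⟩
    convert h3.comp h4 using 2
    · simp
    · simp

/-- For finite first moment, `φ(s) / s` tends to the mass at zero. -/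
lemma tendsto_mul_laplaceExponent (h : firstMoment ν < ⊤) :
    Tendsto (fun n : ℕ => (n + 1 : ℝ) * laplaceExponent ν (1 / (n + 1 : ℝ))) atTop
      (𝓝 (mass ν)) := by
  have h1 := tendsto_ofReal_mul_laplaceExponent (ν := ν)
    fun s hs => integrable_one_sub_exp h hs.le
  have h2 := (ENNReal.tendsto_toReal h.ne).comp h1
  rw [firstMoment_eq_ofReal_mass h, ENNReal.toReal_ofReal (mass_nonneg ν)] at h2
  refine h2.congr fun n => ENNReal.toReal_ofReal ?_
  exact mul_nonneg (by positivity) (laplaceExponent_nonneg (by positivity))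

/-- The Laplace transform of the mass measure vanishes at infinity. -/
lemma tendsto_massTransform_atTop (h : firstMoment ν < ⊤) :
    Tendsto (massTransform ν) atTop (𝓝 0) := by
  have key : Tendsto (massTransform ν) atTop (𝓝 (∫ _x : E, (0 : ℝ) ∂ν)) := by
    refine tendsto_integral_filter_of_dominated_convergence (fun x : E => (x : ℝ))
      (Eventually.of_forall fun s => by fun_prop) ?_ (integrable_coe_iff.2 h)
      (ae_of_all _ fun x => ?_)
    · filter_upwards [eventually_gt_atTop 0] with s hs
      refine ae_of_all _ fun x => ?_
      have hx : (0 : ℝ) < x := x.2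
      rw [Real.norm_of_nonneg (by positivity)]
      exact mul_le_of_le_one_right hx.le (Real.exp_le_one_iff.2 (by linarith [mul_pos hs hx]))
    · have h1 : Tendsto (fun s : ℝ => s * (x : ℝ)) atTop atTop := tendsto_id.atTop_mul_const x.2
      simpa using (Real.tendsto_exp_neg_atTop_nhds_zero.comp h1).const_mul (x : ℝ)
  simpa using key

/-- The Laplace transform of the mass measure tends to the mass at zero. -/
lemma tendsto_massTransform_zero (h : firstMoment ν < ⊤) :
    Tendsto (massTransform ν) (𝓝[≥] 0) (𝓝 (mass ν)) := by
  refine tendsto_integral_filter_of_dominated_convergence (fun x : E => (x : ℝ))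
    (Eventually.of_forall fun s => by fun_prop) ?_ (integrable_coe_iff.2 h)
    (ae_of_all _ fun x => ?_)
  · filter_upwards [self_mem_nhdsWithin] with s hs
    refine ae_of_all _ fun x => ?_
    have hx : (0 : ℝ) < x := x.2
    rw [Real.norm_of_nonneg (by positivity)]
    exact mul_le_of_le_one_right hx.le
      (Real.exp_le_one_iff.2 (by linarith [mul_nonneg (mem_Ici.1 hs) hx.le]))
  · have : Continuous fun s : ℝ => (x : ℝ) * Real.exp (-(s * x)) := by fun_prop
    simpa using (this.tendsto 0).mono_left nhdsWithin_le_nhds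

end

/-! ### Functions that act positively on exponential sums -/

/-- `F` acts positively on exponential sums: whenever `∑ aᵢ e^{-σᵢ x} ≥ 0` for all `x ≥ 0`, also
`∑ aᵢ F(σᵢ) ≥ 0`. Up to continuity at zero this characterizes Laplace transforms of finite
measures. -/
def IsLaplacePositive (F : ℝ → ℝ) : Prop :=
  ∀ (ι : Type) (T : Finset ι) (σ a : ι → ℝ), (∀ i, 0 ≤ σ i) →
    (∀ x, 0 ≤ x → 0 ≤ ∑ i ∈ T, a i * Real.exp (-(σ i * x))) → 0 ≤ ∑ i ∈ T, a i * F (σ i)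

namespace IsLaplacePositive

variable {F G : ℝ → ℝ}

lemma exp {y : ℝ} (hy : 0 ≤ y) : IsLaplacePositive fun s => Real.exp (-(s * y)) :=
  fun _ _ _ _ _ h => h y hy

lemma add (hF : IsLaplacePositive F) (hG : IsLaplacePositive G) :
    IsLaplacePositive fun s => F s + G s := fun ι T σ a hσ h => by
  simpa only [mul_add, Finset.sum_add_distrib] using add_nonneg (hF ι T σ a hσ h) (hG ι T σ a hσ h)

lemma const_mul {c : ℝ} (hc : 0 ≤ c) (hF : IsLaplacePositive F) :
    IsLaplacePositive fun s => c * F s := fun ι T σ a hσ h => by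
  have := mul_nonneg hc (hF ι T σ a hσ h)
  rw [Finset.mul_sum] at this
  exact this.trans_eq (Finset.sum_congr rfl fun i _ => by ring)

lemma const {c : ℝ} (hc : 0 ≤ c) : IsLaplacePositive fun _ => c := by
  simpa using (exp le_rfl).const_mul hc

/-- This mirrors convolution of measures. Reading the hypothesis at `x + y` shows that the
coefficients `aᵢ e^{-σᵢ y}` are admissible for `F` for each `y ≥ 0`; the resulting inequality says
that the `aᵢ F(σᵢ)` are admissible for `G`. -/
lemma mul (hF : IsLaplacePositive F) (hG : IsLaplacePositive G) :
    IsLaplacePositive fun s => F s * G s := fun ι T σ a hσ h => by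
  have := hG ι T σ (fun i => a i * F (σ i)) hσ fun y hy => by
    have := hF ι T σ (fun i => a i * Real.exp (-(σ i * y))) hσ fun x hx => by
      refine (h (x + y) (by positivity)).trans_eq (Finset.sum_congr rfl fun i _ => ?_)
      rw [mul_assoc, ← Real.exp_add]
      congr 2; ring
    exact this.trans_eq (Finset.sum_congr rfl fun i _ => by ring)
  exact this.trans_eq (Finset.sum_congr rfl fun i _ => by ring)

lemma pow (hF : IsLaplacePositive F) (n : ℕ) : IsLaplacePositive fun s => F s ^ n := by
  induction n with
  | zero => simpa using const zero_le_one
  | succ n ih => simpa only [pow_succ] using ih.mul hF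

lemma congr (hF : IsLaplacePositive F) (h : ∀ s, 0 ≤ s → G s = F s) : IsLaplacePositive G :=
  fun ι T σ a hσ hp =>
    (hF ι T σ a hσ hp).trans_eq (Finset.sum_congr rfl fun i _ => by rw [h _ (hσ i)])

/-- Each instance of the condition involves finitely many values of `F`, so pointwise convergence
suffices and no tightness of underlying measures has to be tracked. -/
lemma of_tendsto {α : Type*} {l : Filter α} [l.NeBot] {f : α → ℝ → ℝ}
    (hf : ∀ᶠ n in l, IsLaplacePositive (f n))
    (h : ∀ s, 0 ≤ s → Tendsto (fun n => f n s) l (𝓝 (F s))) : IsLaplacePositive F :=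
  fun ι T σ a hσ hp =>
    ge_of_tendsto (tendsto_finsetSum T fun i _ => (h (σ i) (hσ i)).const_mul (a i))
      (hf.mono fun _ hn => hn ι T σ a hσ hp)

lemma integral {X : Type*} [MeasurableSpace X] {μ : Measure X} {f : X → ℝ → ℝ}
    (hf : ∀ x, IsLaplacePositive (f x)) (hi : ∀ s, 0 ≤ s → Integrable (fun x => f x s) μ) :
    IsLaplacePositive fun s => ∫ x, f x s ∂μ := fun ι T σ a hσ hp => by
  have : ∑ i ∈ T, a i * ∫ x, f x (σ i) ∂μ = ∫ x, ∑ i ∈ T, a i * f x (σ i) ∂μ := by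
    rw [integral_finsetSum _ fun i _ => (hi (σ i) (hσ i)).const_mul (a i)]
    exact Finset.sum_congr rfl fun i _ => (integral_const_mul _ _).symm
  rw [this]
  exact integral_nonneg fun x => hf x ι T σ a hσ hp

/-- Multiplying a nonnegative exponential sum by `1 - e^{-x} ≥ 0` gives another one, with exponents
`σᵢ` and `σᵢ + 1` and coefficients `aᵢ` and `-aᵢ`. -/
lemma sub_shift (hF : IsLaplacePositive F) : IsLaplacePositive fun s => F s - F (s + 1) :=
  fun ι T σ a hσ hp => by
    have := hF (ι ⊕ ι) (T.disjSum T) (Sum.elim σ fun i => σ i + 1) (Sum.elim a fun i => -a i)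
      (by rintro (i | i) <;> simp [hσ i, add_nonneg (hσ i) zero_le_one]) fun x hx => by
        rw [Finset.sum_disjSum]
        have h1 := mul_nonneg (hp x hx) (one_sub_exp_neg_nonneg hx)
        rw [Finset.sum_mul] at h1
        rw [← Finset.sum_add_distrib]
        refine h1.trans_eq (Finset.sum_congr rfl fun i _ => ?_)
        have : Real.exp (-((σ i + 1) * x)) = Real.exp (-(σ i * x)) * Real.exp (-x) := by
          rw [← Real.exp_add]; congr 1; ring
        simp only [Sum.elim_inl, Sum.elim_inr, this]
        ring
    rw [Finset.sum_disjSum, ← Finset.sum_add_distrib] at this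
    exact this.trans_eq (Finset.sum_congr rfl fun i _ => by simp; ring)

open scoped NNReal unitInterval CompactlySupported in
/-- A function acting positively on exponential sums is a Laplace transform (in the variable
`z = e^{-x}`, where `z = 0` stands for `x = ∞`). -/
theorem exists_measure (hG : IsLaplacePositive G) :
    ∃ ρ : Measure I, IsFiniteMeasure ρ ∧ ∀ s : ℝ, 0 ≤ s → ∫ z : I, (z : ℝ) ^ s ∂ρ = G s := by
  let e : ℝ≥0 → C(I, ℝ) := fun s => ⟨fun z => (z : ℝ) ^ (s : ℝ),
    (Real.continuous_rpow_const s.2).comp continuous_subtype_val⟩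
  let ev := Finsupp.linearCombination ℝ e
  let Λ := Finsupp.linearCombination ℝ fun s : ℝ≥0 => G s
  have hpos : ∀ a, 0 ≤ ev a → 0 ≤ Λ a := by
    intro a ha
    have := hG ℝ≥0 a.support (fun s => s) a (fun s => s.2) fun x hx => by
      have h1 : 0 ≤ ev a ⟨Real.exp (-x), (Real.exp_pos _).le, Real.exp_le_one_iff.2 (by linarith)⟩ :=
        ha _
      simp only [ev, Finsupp.linearCombination_apply, Finsupp.sum,
        ContinuousMap.sum_apply, ContinuousMap.smul_apply, smul_eq_mul] at h1
      refine h1.trans_eq (Finset.sum_congr rfl fun s _ => ?_)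
      change a s * Real.exp (-x) ^ (s : ℝ) = _
      rw [← Real.exp_mul]
      congr 2; ring
    simpa [Λ, Finsupp.linearCombination_apply, Finsupp.sum] using this
  -- A combination that vanishes as a function is nonnegative with either sign, so `Λ` descends to a
  -- functional on the span of the powers `z^s`.
  have hker : LinearMap.ker ev ≤ LinearMap.ker Λ := fun a ha => by
    rw [LinearMap.mem_ker] at ha ⊢
    refine le_antisymm ?_ (hpos a ha.ge)
    have := hpos (-a) (by rw [map_neg, ha, neg_zero])
    rw [map_neg] at this
    linarith
  let f : C(I, ℝ) →ₗ.[ℝ] ℝ := ⟨LinearMap.range ev,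
    (LinearMap.ker ev).liftQ Λ hker ∘ₗ ev.quotKerEquivRange.symm.toLinearMap⟩
  have hf : ∀ a, f ⟨ev a, a, rfl⟩ = Λ a := fun a => by
    have : ev.quotKerEquivRange.symm ⟨ev a, a, rfl⟩ = Submodule.Quotient.mk a := by
      rw [LinearEquiv.symm_apply_eq]; rfl
    change (LinearMap.ker ev).liftQ Λ hker (ev.quotKerEquivRange.symm ⟨ev a, a, rfl⟩) = _
    rw [this]; rfl
  have he : ∀ s, ev (Finsupp.single s 1) = e s := fun s => by simp [ev]
  -- The span contains the constants (`z^0 = 1`, also at `z = 0`), and adding `‖y‖` makes any `y`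
  -- nonnegative. This is the cofinality needed to extend `f` to a positive functional on all of
  -- `C(I, ℝ)`.
  obtain ⟨g, hg, hg0⟩ := riesz_extension (PointedCone.positive ℝ C(I, ℝ)) f
    (by
      rintro ⟨_, a, rfl⟩ h
      rw [hf]
      exact hpos a h)
    (fun y => ⟨⟨ev (Finsupp.single 0 ‖y‖), _, rfl⟩, fun z => by
      have := (abs_le.1 (y.norm_coe_le_norm z)).1
      simp [ev, e]
      linarith⟩)
  let g' : C_c(I, ℝ) →ₚ[ℝ] ℝ := PositiveLinearMap.mk₀
    { toFun := fun h => g h.toContinuousMap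
      map_add' := fun a b => by rw [← map_add]; rfl
      map_smul' := fun c a => by rw [← map_smul]; rfl } fun h hh => hg0 _ fun z => hh z
  refine ⟨RealRMK.rieszMeasure g', inferInstance, fun s hs => ?_⟩
  lift s to ℝ≥0 using hs
  have h1 := RealRMK.integral_rieszMeasure g'
    (CompactlySupportedContinuousMap.continuousMapEquiv (e s))
  refine h1.trans ?_
  change g (e s) = G s
  have h2 : g (ev (Finsupp.single s 1)) = Λ (Finsupp.single s 1) :=
    (hg ⟨ev (Finsupp.single s 1), _, rfl⟩).trans (hf _)
  rw [← he s, h2]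
  simp [Λ]

end IsLaplacePositive

/-- `e^{-au}` acts positively on exponential sums for every `a ≥ 0`. -/
def IsBernsteinExponent (u : ℝ → ℝ) : Prop :=
  ∀ a, 0 ≤ a → IsLaplacePositive fun s => Real.exp (-(a * u s))

namespace IsBernsteinExponent

variable {u v : ℝ → ℝ}

lemma id : IsBernsteinExponent fun s => s := fun _ ha =>
  (IsLaplacePositive.exp ha).congr fun s _ => by rw [mul_comm]

lemma add (hu : IsBernsteinExponent u) (hv : IsBernsteinExponent v) :
    IsBernsteinExponent fun s => u s + v s := fun a ha =>
  ((hu a ha).mul (hv a ha)).congr fun s _ => by rw [← Real.exp_add]; congr 1; ring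

lemma const_mul {c : ℝ} (hc : 0 ≤ c) (hu : IsBernsteinExponent u) :
    IsBernsteinExponent fun s => c * u s := fun a ha =>
  (hu (a * c) (mul_nonneg ha hc)).congr fun s _ => by congr 1; ring

lemma of_tendsto {α : Type*} {l : Filter α} [l.NeBot] {f : α → ℝ → ℝ}
    (hf : ∀ᶠ n in l, IsBernsteinExponent (f n))
    (h : ∀ s, 0 ≤ s → Tendsto (fun n => f n s) l (𝓝 (u s))) : IsBernsteinExponent u :=
  fun a ha => .of_tendsto (hf.mono fun _ hn => hn a ha) fun s hs =>
    (Real.continuous_exp.tendsto _).comp ((h s hs).const_mul a).neg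

/-- For finite `ν` the exponent at `u` is `ν(E) - L` with `L = ∫ e^{-xu} ν(dx)` acting positively.
Then `1 - aφ(u)/n = (1 - aν(E)/n) + (a/n) L` acts positively as soon as `n ≥ aν(E)`, and its `n`-th
power tends to `e^{-aφ(u)}`. -/
lemma laplaceExponent_comp_of_isFiniteMeasure {ν : Measure E} [IsFiniteMeasure ν]
    (hu : IsBernsteinExponent u) (hu0 : ∀ s, 0 ≤ s → 0 ≤ u s) :
    IsBernsteinExponent fun s => laplaceExponent ν (u s) := fun a ha => by
  have hint : ∀ s, 0 ≤ s → Integrable (fun x : E => Real.exp (-(x * u s))) ν := fun s hs => by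
    refine (integrable_const (1 : ℝ)).mono' (by fun_prop) (ae_of_all _ fun x => ?_)
    rw [Real.norm_of_nonneg (Real.exp_pos _).le, Real.exp_le_one_iff]
    linarith [mul_nonneg (le_of_lt x.2) (hu0 s hs)]
  have hL := IsLaplacePositive.integral (μ := ν) (f := fun (x : E) s => Real.exp (-(x * u s)))
    (fun x => hu x x.2.le) hint
  have heq : ∀ s, 0 ≤ s → laplaceExponent ν (u s) =
      ν.real univ - ∫ x : E, Real.exp (-(x * u s)) ∂ν := fun s hs => by
    simp_rw [laplaceExponent, mul_comm (u s)]
    rw [integral_sub (integrable_const _) (hint s hs)]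
    simp
  refine .of_tendsto (l := atTop)
    (f := fun (n : ℕ) s => (1 + -(a * laplaceExponent ν (u s)) / n) ^ n)
    ?_ fun s hs => Real.tendsto_one_add_div_pow_exp _
  filter_upwards [tendsto_natCast_atTop_atTop.eventually_ge_atTop (a * ν.real univ),
    eventually_gt_atTop 0] with n hn hn0
  have hn0' : (0 : ℝ) < n := by exact_mod_cast hn0
  refine IsLaplacePositive.pow (IsLaplacePositive.congr ((IsLaplacePositive.const
    (sub_nonneg.2 ((div_le_one hn0').2 hn))).add (hL.const_mul (c := a / n) (by positivity)))
    fun s hs => ?_) n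
  rw [heq s hs]
  ring

/-- Bernstein exponents are stable under composition with Laplace exponents. -/
lemma laplaceExponent_comp {ν : Measure E} (hν : firstMoment ν < ⊤)
    (hu : IsBernsteinExponent u) (hu0 : ∀ s, 0 ≤ s → 0 ≤ u s) :
    IsBernsteinExponent fun s => laplaceExponent ν (u s) := by
  -- Only small sizes can carry infinite measure: cutting them off leaves a finite measure by
  -- Markov's inequality, and the cut-offs exhaust `E`.
  let A : ℕ → Set E := fun k => {x : E | 1 / (k + 1 : ℝ) ≤ x}
  have hA : ∀ k, MeasurableSet (A k) := fun k => measurableSet_le (by fun_prop) (by fun_prop)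
  have hfin : ∀ k, IsFiniteMeasure (ν.restrict (A k)) := fun k => ⟨by
    rw [Measure.restrict_apply_univ]
    exact (integrable_coe_iff.2 hν).measure_ge_lt_top (by positivity)⟩
  refine .of_tendsto (l := atTop) (f := fun (k : ℕ) s => laplaceExponent (ν.restrict (A k)) (u s))
    (Eventually.of_forall fun k => hu.laplaceExponent_comp_of_isFiniteMeasure hu0) fun s hs => ?_
  have hU : ⋃ k, A k = univ := eq_univ_of_forall fun x => by
    obtain ⟨k, hk⟩ := exists_nat_one_div_lt (mem_Ioi.1 x.2)
    exact mem_iUnion.2 ⟨k, hk.le⟩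
  have := tendsto_setIntegral_of_monotone (μ := ν)
    (f := fun x : E => 1 - Real.exp (-(u s * x))) hA
    (fun k l hkl x (hx : 1 / (k + 1 : ℝ) ≤ x) =>
      show 1 / (l + 1 : ℝ) ≤ x from (Nat.one_div_le_one_div hkl).trans hx)
    (by rw [hU]; exact (integrable_one_sub_exp hν (hu0 s hs)).integrableOn)
  rwa [hU, setIntegral_univ] at this

end IsBernsteinExponent

/-! ### Bernstein exponents are Laplace exponents -/

/-- A Bernstein function is not itself a Laplace transform, but its unit increment should be that of
`(1 - e^{-x}) ν(dx)`. It appears as the limit of `(e^{-au(s)} - e^{-au(s+1)})/a` for `a ↓ 0`. -/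
lemma IsBernsteinExponent.isLaplacePositive_diff {u : ℝ → ℝ} (hu : IsBernsteinExponent u) :
    IsLaplacePositive fun s => u (s + 1) - u s := by
  refine .of_tendsto (l := 𝓝[>] (0 : ℝ))
    (f := fun a s => a⁻¹ * (Real.exp (-(a * u s)) - Real.exp (-(a * u (s + 1))))) ?_ fun s _ => ?_
  · filter_upwards [self_mem_nhdsWithin] with a ha
    exact ((hu a (le_of_lt ha)).sub_shift).const_mul (inv_nonneg.2 (le_of_lt ha))
  · have h : ∀ p : ℝ, HasDerivAt (fun a : ℝ => Real.exp (-(a * p))) (-p) 0 := fun p => by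
      have h1 : HasDerivAt (fun a : ℝ => -(a * p)) (-(1 * p)) 0 :=
        ((hasDerivAt_id _).mul_const _).neg
      simpa using h1.exp
    have := ((h (u s)).sub (h (u (s + 1)))).tendsto_slope_zero_right
    simpa [neg_add_eq_sub] using this

section Rep

open scoped unitInterval

/-- The change of variables `z = e^{-x}` from `(0,1)` to `(0,∞)`. -/
noncomputable def negLog (z : I) : E :=
  ⟨if (0 : ℝ) < z ∧ (z : ℝ) < 1 then -Real.log z else 1, by
    split_ifs with h
    · exact mem_Ioi.2 (neg_pos.2 (Real.log_neg h.1 h.2))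
    · exact mem_Ioi.2 one_pos⟩

lemma measurable_negLog : Measurable negLog := by
  refine Measurable.subtype_mk (Measurable.ite ?_ (by fun_prop) measurable_const)
  exact (measurableSet_lt measurable_const measurable_subtype_coe).inter
    (measurableSet_lt measurable_subtype_coe measurable_const)

lemma exp_neg_mul_negLog {z : I} (h0 : (0 : ℝ) < z) (h1 : (z : ℝ) < 1) (s : ℝ) :
    Real.exp (-(s * negLog z)) = (z : ℝ) ^ s := by
  rw [Real.rpow_def_of_pos h0]
  simp only [negLog, h0, h1, and_self, if_true]
  congr 1; ring

/-- An atom at `z = 0` is mass at `x = ∞` and would make the transform jump at `s = 0`. An atom at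
`z = 1` is mass at `x = 0`, a drift, and would survive as `s → ∞`. -/
lemma ae_mem_Ioo_of_tendsto {ρ : Measure I} [IsFiniteMeasure ρ]
    (h0 : Tendsto (fun n : ℕ => ∫ z : I, (z : ℝ) ^ (1 / (n + 1 : ℝ)) ∂ρ) atTop
      (𝓝 (ρ.real univ)))
    (h1 : Tendsto (fun n : ℕ => ∫ z : I, (z : ℝ) ^ (n : ℝ) ∂ρ) atTop (𝓝 0)) :
    ∀ᵐ z : I ∂ρ, (0 : ℝ) < z ∧ (z : ℝ) < 1 := by
  have hb : ∀ s : ℝ, 0 ≤ s → ∀ z : I, ‖(z : ℝ) ^ s‖ ≤ 1 := fun s hs z => by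
    rw [Real.norm_of_nonneg (Real.rpow_nonneg z.2.1 _)]
    exact Real.rpow_le_one z.2.1 z.2.2 hs
  have hm : ∀ s : ℝ, AEStronglyMeasurable (fun z : I => (z : ℝ) ^ s) ρ := fun s =>
    (measurable_subtype_coe.pow_const s).aestronglyMeasurable
  have e0 : Tendsto (fun n : ℕ => ∫ z : I, (z : ℝ) ^ (1 / (n + 1 : ℝ)) ∂ρ) atTop
      (𝓝 (∫ z : I, ({(0 : I)}ᶜ : Set I).indicator 1 z ∂ρ)) := by
    refine tendsto_integral_of_dominated_convergence (fun _ => (1 : ℝ)) (fun n => hm _)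
      (integrable_const _) (fun n => ae_of_all _ (hb _ (by positivity))) (ae_of_all _ fun z => ?_)
    by_cases hz : z = 0
    · subst hz
      have : ∀ n : ℕ, ((0 : I) : ℝ) ^ (1 / (n + 1 : ℝ)) = 0 := fun n => by
        exact Real.zero_rpow (by positivity)
      simp only [this]
      simp
    · have hz' : (z : ℝ) ≠ 0 := fun h => hz (Subtype.ext h)
      have := (Real.continuous_const_rpow hz').tendsto 0 |>.comp
        (tendsto_one_div_add_atTop_nhds_zero_nat (𝕜 := ℝ))
      simpa [hz, Function.comp_def] using this
  have e1 : Tendsto (fun n : ℕ => ∫ z : I, (z : ℝ) ^ (n : ℝ) ∂ρ) atTop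
      (𝓝 (∫ z : I, ({(1 : I)} : Set I).indicator 1 z ∂ρ)) := by
    refine tendsto_integral_of_dominated_convergence (fun _ => (1 : ℝ)) (fun n => hm _)
      (integrable_const _) (fun n => ae_of_all _ (hb _ (by positivity))) (ae_of_all _ fun z => ?_)
    by_cases hz : z = 1
    · subst hz; simp
    · have hz' : (z : ℝ) < 1 := lt_of_le_of_ne z.2.2 fun h => hz (Subtype.ext h)
      simpa [hz] using tendsto_pow_atTop_nhds_zero_of_lt_one z.2.1 hz'
  rw [integral_indicator_one (measurableSet_singleton _).compl] at e0
  rw [integral_indicator_one (measurableSet_singleton _)] at e1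
  have f0 : ρ.real {(0 : I)} = 0 := by
    have := tendsto_nhds_unique e0 h0
    rw [measureReal_compl (measurableSet_singleton _)] at this
    linarith
  have f1 : ρ.real {(1 : I)} = 0 := tendsto_nhds_unique e1 h1
  rw [measureReal_eq_zero_iff] at f0 f1
  have g0 : ∀ᵐ z ∂ρ, z ≠ 0 := by simpa [ae_iff] using f0
  have g1 : ∀ᵐ z ∂ρ, z ≠ 1 := by simpa [ae_iff] using f1
  filter_upwards [g0, g1] with z hz0 hz1
  exact ⟨lt_of_le_of_ne z.2.1 fun h => hz0 (Subtype.ext h.symm),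
    lt_of_le_of_ne z.2.2 fun h => hz1 (Subtype.ext h)⟩

end Rep

/-- Two functions with the same unit increments, vanishing at zero, monotone and with increments
tending to zero, agree. -/
lemma eq_of_increments_eq {u U : ℝ → ℝ} (hu : MonotoneOn u (Ici 0)) (hU : MonotoneOn U (Ici 0))
    (h0 : u 0 = U 0) (hinc : ∀ s, 0 ≤ s → U (s + 1) - U s = u (s + 1) - u s)
    (hlim : Tendsto (fun n : ℕ => u (n + 1) - u n) atTop (𝓝 0)) {s : ℝ} (hs : 0 ≤ s) :
    U s = u s := by
  have hper : ∀ s, 0 ≤ s → ∀ n : ℕ, U (s + n) - u (s + n) = U s - u s := fun s hs n => by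
    induction n with
    | zero => simp
    | succ n ih =>
      have := hinc (s + n) (by positivity)
      push_cast
      rw [← add_assoc]
      linarith
  -- By `hper`, `U - u` has period one and vanishes at integers. On `[n, n+1]` both functions lie
  -- between the same endpoint values, so their difference is at most the increment there, which
  -- tends to zero.
  have hloc : ∀ r, 0 ≤ r → r ≤ 1 → U r - u r = 0 := fun r hr hr1 => by
    have hle : ∀ n : ℕ, |U r - u r| ≤ u (n + 1) - u n := fun n => by
      have h1 := hper r hr n
      have h2 := hper 0 le_rfl n
      rw [h0, sub_self, zero_add] at h2
      have h3 := hinc n n.cast_nonneg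
      have hn : (0 : ℝ) ≤ n := n.cast_nonneg
      have a1 := hu (mem_Ici.2 hn) (mem_Ici.2 (add_nonneg hr hn)) (by linarith)
      have a2 := hu (mem_Ici.2 (add_nonneg hr hn)) (mem_Ici.2 (add_nonneg hn zero_le_one))
        (by linarith)
      have a3 := hU (mem_Ici.2 hn) (mem_Ici.2 (add_nonneg hr hn)) (by linarith)
      have a4 := hU (mem_Ici.2 (add_nonneg hr hn)) (mem_Ici.2 (add_nonneg hn zero_le_one))
        (by linarith)
      rw [abs_le]
      constructor <;> linarith
    exact abs_nonpos_iff.1 (ge_of_tendsto' hlim hle)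
  have h1 := hper (Int.fract s) (Int.fract_nonneg s) ⌊s⌋₊
  have h2 : Int.fract s + (⌊s⌋₊ : ℝ) = s := by
    rw [natCast_floor_eq_intCast_floor hs, Int.fract_add_floor]
  rw [h2, hloc _ (Int.fract_nonneg s) (Int.fract_lt_one s).le] at h1
  linarith

/-- Bernoulli's inequality for `(e^{-x})^N`. It bounds `(1 - e^{-sx})/(1 - e^{-x})`, giving
integrability against a finite measure. -/
lemma one_sub_exp_neg_mul_le {x : ℝ} (hx : 0 ≤ x) {s : ℝ} {N : ℕ} (hN : s ≤ N) :
    1 - Real.exp (-(s * x)) ≤ N * (1 - Real.exp (-x)) := by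
  have h1 := one_add_mul_le_pow (a := Real.exp (-x) - 1)
    (by linarith [Real.exp_pos (-x)]) N
  have h2 : (1 + (Real.exp (-x) - 1)) ^ N = Real.exp (-(N * x)) := by
    rw [add_sub_cancel, ← Real.exp_nat_mul]; congr 1; ring
  have h3 : Real.exp (-(N * x)) ≤ Real.exp (-(s * x)) :=
    Real.exp_le_exp.2 (neg_le_neg (mul_le_mul_of_nonneg_right hN hx))
  rw [h2] at h1
  linarith

/-- A Bernstein exponent vanishing at zero, without drift, is the Laplace exponent of a measure
on `(0,∞)`. -/
theorem IsBernsteinExponent.exists_measure {u : ℝ → ℝ} (hu : IsBernsteinExponent u)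
    (h0 : u 0 = 0) (hmono : MonotoneOn u (Ici 0)) (hcont : ContinuousOn u (Ici 0))
    (hlim : Tendsto (fun n : ℕ => u (n + 1) - u n) atTop (𝓝 0)) :
    ∃ ν : Measure E, ∀ s, 0 ≤ s →
      Integrable (fun x : E => 1 - Real.exp (-(s * x))) ν ∧ laplaceExponent ν s = u s := by
  obtain ⟨ρ, hρ, hρG⟩ := hu.isLaplacePositive_diff.exists_measure
  have hae := ae_mem_Ioo_of_tendsto (ρ := ρ)
    (by
      have e1 : ρ.real univ = u (0 + 1) - u 0 := by simpa using hρG 0 le_rfl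
      have e2 : ∀ n : ℕ, ∫ z : unitInterval, (z : ℝ) ^ (1 / (n + 1 : ℝ)) ∂ρ =
          u (1 / (n + 1 : ℝ) + 1) - u (1 / (n + 1 : ℝ)) := fun n => hρG _ (by positivity)
      simp only [e1, e2]
      have hl : Tendsto (fun n : ℕ => 1 / (n + 1 : ℝ)) atTop (𝓝 0) :=
        tendsto_one_div_add_atTop_nhds_zero_nat
      refine Tendsto.sub ?_ ?_
      · refine (hcont (0 + 1) (by simp)).tendsto.comp (tendsto_nhdsWithin_iff.2
          ⟨hl.add_const 1, Eventually.of_forall fun n => mem_Ici.2 (by positivity)⟩)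
      · refine (hcont 0 (by simp)).tendsto.comp (tendsto_nhdsWithin_iff.2
          ⟨hl, Eventually.of_forall fun n => mem_Ici.2 (by positivity)⟩))
    (by
      refine hlim.congr fun n => ?_
      rw [hρG n n.cast_nonneg])
  let lam : Measure E := ρ.map negLog
  have hlam : IsFiniteMeasure lam := Measure.isFiniteMeasure_map ρ negLog
  have hlamG : ∀ s, 0 ≤ s → ∫ x : E, Real.exp (-(s * x)) ∂lam = u (s + 1) - u s := fun s hs => by
    rw [← hρG s hs, integral_map measurable_negLog.aemeasurable (by fun_prop)]
    exact integral_congr_ae (hae.mono fun z hz => exp_neg_mul_negLog hz.1 hz.2 s)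
  -- The increments of the exponent of `ν` are the transform of `(1 - e^{-x}) ν(dx)`, so `ν` is
  -- recovered from `lam` by dividing by `1 - e^{-x}`.
  let d : E → ℝ := fun x => (1 - Real.exp (-x))⁻¹
  have hpos : ∀ x : E, 0 < 1 - Real.exp (-(x : ℝ)) := fun x =>
    sub_pos.2 (Real.exp_lt_one_iff.2 (neg_lt_zero.2 x.2))
  have hd : ∀ x, 0 < d x := fun x => inv_pos.2 (hpos x)
  have hdm : Measurable fun x => ENNReal.ofReal (d x) := by fun_prop
  let h : ℝ → E → ℝ := fun s x => d x * (1 - Real.exp (-(s * x)))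
  have hint : ∀ s, 0 ≤ s → Integrable (h s) lam := fun s hs => by
    obtain ⟨N, hN⟩ := exists_nat_ge s
    refine (integrable_const (N : ℝ)).mono' (by fun_prop) (ae_of_all _ fun x => ?_)
    have hx : (0 : ℝ) ≤ x := le_of_lt x.2
    rw [Real.norm_of_nonneg (mul_nonneg (hd x).le (one_sub_exp_neg_nonneg (mul_nonneg hs hx))),
      inv_mul_le_iff₀ (hpos x), mul_comm _ (N : ℝ)]
    exact one_sub_exp_neg_mul_le hx hN
  let ν := lam.withDensity fun x => ENNReal.ofReal (d x)
  have hsm : ∀ s x, (ENNReal.ofReal (d x)).toReal • (1 - Real.exp (-(s * (x : ℝ)))) = h s x :=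
    fun s x => by rw [ENNReal.toReal_ofReal (hd x).le, smul_eq_mul]
  have hLE : ∀ s, laplaceExponent ν s = ∫ x, h s x ∂lam := fun s => by
    rw [laplaceExponent, integral_withDensity_eq_integral_toReal_smul hdm
      (ae_of_all _ fun x => ENNReal.ofReal_lt_top)]
    exact integral_congr_ae (ae_of_all _ (hsm s))
  refine ⟨ν, fun s hs => ⟨?_, ?_⟩⟩
  · rw [integrable_withDensity_iff_integrable_smul' hdm
      (ae_of_all _ fun x => ENNReal.ofReal_lt_top)]
    simpa only [hsm] using hint s hs
  · refine eq_of_increments_eq hmono ?_ (by rw [h0, laplaceExponent_zero]) ?_ hlim hs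
    · intro s hs t ht hst
      rw [hLE, hLE]
      refine integral_mono (hint s hs) (hint t ht) fun x => mul_le_mul_of_nonneg_left ?_ (hd x).le
      have := Real.exp_le_exp.2 (neg_le_neg (mul_le_mul_of_nonneg_right hst (le_of_lt x.2)))
      linarith
    · intro s hs
      rw [hLE, hLE, ← integral_sub (hint _ (by positivity)) (hint s hs), ← hlamG s hs]
      refine integral_congr_ae (ae_of_all _ fun x => ?_)
      have e : Real.exp (-((s + 1) * (x : ℝ))) = Real.exp (-(s * x)) * Real.exp (-x) := by
        rw [← Real.exp_add]; congr 1; ring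
      simp only [h, d, e]
      have := (hpos x).ne'
      field_simp
      ring

/-! ### The characteristic equation `v = s + θ φ(v)` -/

/-- Iterates of `v ↦ s + θ φ(v)` started at `v = s`. -/
noncomputable def charIter (ν : Measure E) (θ : ℝ) : ℕ → ℝ → ℝ
  | 0, s => s
  | k + 1, s => s + θ * laplaceExponent ν (charIter ν θ k s)

/-- The solution `v` of the characteristic equation `v = s + θ φ(v)`. -/
noncomputable def charRoot (ν : Measure E) (θ s : ℝ) : ℝ := ⨆ k, charIter ν θ k s

section

variable {ν : Measure E} {θ s : ℝ}

lemma le_charIter (hθ : 0 ≤ θ) (hs : 0 ≤ s) (k : ℕ) : s ≤ charIter ν θ k s := by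
  induction k with
  | zero => exact le_rfl
  | succ k ih => exact le_add_of_nonneg_right (mul_nonneg hθ (laplaceExponent_nonneg (hs.trans ih)))

/-- Since `φ(v) ≤ mv`, the iterates stay below the fixed point of the affine map `v ↦ s + θmv`. -/
lemma charIter_le (h : firstMoment ν < ⊤) (hθ : 0 ≤ θ) (hθm : θ * mass ν < 1) (hs : 0 ≤ s)
    (k : ℕ) : charIter ν θ k s ≤ s / (1 - θ * mass ν) := by
  have hpos : 0 < 1 - θ * mass ν := sub_pos.2 hθm
  rw [le_div_iff₀ hpos]
  induction k with
  | zero =>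
    have := mul_nonneg hθ (mass_nonneg ν)
    simp only [charIter]
    nlinarith
  | succ k ih =>
    have h1 := laplaceExponent_le h (hs.trans (le_charIter (ν := ν) hθ hs k))
    have h2 := mul_le_mul_of_nonneg_left h1 hθ
    have h3 := mul_le_mul_of_nonneg_left ih (mul_nonneg hθ (mass_nonneg ν))
    simp only [charIter]
    nlinarith

lemma charIter_mono (h : firstMoment ν < ⊤) (hθ : 0 ≤ θ) (hs : 0 ≤ s) :
    Monotone fun k => charIter ν θ k s := monotone_nat_of_le_succ fun k => by
  induction k with
  | zero => exact le_charIter hθ hs 1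
  | succ k ih =>
    exact add_le_add_right (mul_le_mul_of_nonneg_left
      (laplaceExponent_mono h (hs.trans (le_charIter hθ hs k)) ih) hθ) s

/-- Boundedness makes the supremum in `charRoot` genuine rather than the default value of an
unbounded real supremum. -/
lemma tendsto_charIter (h : firstMoment ν < ⊤) (hθ : 0 ≤ θ) (hθm : θ * mass ν < 1) (hs : 0 ≤ s) :
    Tendsto (fun k => charIter ν θ k s) atTop (𝓝 (charRoot ν θ s)) :=
  tendsto_atTop_ciSup (charIter_mono h hθ hs)
    ⟨s / (1 - θ * mass ν), forall_mem_range.2 (charIter_le h hθ hθm hs)⟩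

lemma le_charRoot (h : firstMoment ν < ⊤) (hθ : 0 ≤ θ) (hθm : θ * mass ν < 1) (hs : 0 ≤ s) :
    s ≤ charRoot ν θ s :=
  ge_of_tendsto' (tendsto_charIter h hθ hθm hs) (le_charIter hθ hs)

lemma charRoot_le (h : firstMoment ν < ⊤) (hθ : 0 ≤ θ) (hθm : θ * mass ν < 1) (hs : 0 ≤ s) :
    charRoot ν θ s ≤ s / (1 - θ * mass ν) :=
  le_of_tendsto' (tendsto_charIter h hθ hθm hs) (charIter_le h hθ hθm hs)

lemma charRoot_eq (h : firstMoment ν < ⊤) (hθ : 0 ≤ θ) (hθm : θ * mass ν < 1) (hs : 0 ≤ s) :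
    charRoot ν θ s = s + θ * laplaceExponent ν (charRoot ν θ s) := by
  have h1 := tendsto_charIter h hθ hθm hs
  refine tendsto_nhds_unique ((tendsto_add_atTop_iff_nat 1).2 h1) ?_
  refine ((Tendsto.comp (continuousOn_laplaceExponent h _
    (hs.trans (le_charRoot h hθ hθm hs))).tendsto
    (tendsto_nhdsWithin_iff.2 ⟨h1, Eventually.of_forall fun k => ?_⟩)).const_mul θ).const_add s
  exact hs.trans (le_charIter hθ hs k)

/-- This is why the root is built by iteration: every iterate is visibly Bernstein, and the property
passes to pointwise limits. -/
lemma isBernsteinExponent_charRoot (h : firstMoment ν < ⊤) (hθ : 0 ≤ θ)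
    (hθm : θ * mass ν < 1) : IsBernsteinExponent (charRoot ν θ) := by
  refine .of_tendsto (l := atTop) (Eventually.of_forall fun k => ?_)
    fun s hs => tendsto_charIter h hθ hθm hs
  induction k with
  | zero => exact IsBernsteinExponent.id
  | succ k ih =>
    exact IsBernsteinExponent.id.add ((ih.laplaceExponent_comp h
      fun s hs => hs.trans (le_charIter hθ hs k)).const_mul hθ)

/-- Stability of the characteristic equation under perturbations of `θ` and `s`. -/
lemma abs_sub_le_of_char_eq (h : firstMoment ν < ⊤) {θ' s' v v' : ℝ} (hθ : 0 ≤ θ)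
    (hv : 0 ≤ v) (hv' : 0 ≤ v') (e : v = s + θ * laplaceExponent ν v)
    (e' : v' = s' + θ' * laplaceExponent ν v') :
    (1 - θ * mass ν) * |v' - v| ≤ |s' - s| + |θ' - θ| * (mass ν * v') := by
  have h1 : v' - v = (s' - s) + ((θ' - θ) * laplaceExponent ν v' +
      θ * (laplaceExponent ν v' - laplaceExponent ν v)) := by linear_combination e' - e
  have h2 : |v' - v| ≤ |s' - s| + (|θ' - θ| * (mass ν * v') + θ * (mass ν * |v' - v|)) := by
    calc |v' - v| ≤ |s' - s| + |(θ' - θ) * laplaceExponent ν v' +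
          θ * (laplaceExponent ν v' - laplaceExponent ν v)| := by
          rw [h1]; exact abs_add_le _ _
      _ ≤ |s' - s| + (|(θ' - θ) * laplaceExponent ν v'| +
          |θ * (laplaceExponent ν v' - laplaceExponent ν v)|) := by
          gcongr; exact abs_add_le _ _
      _ ≤ _ := by
          rw [abs_mul, abs_mul, abs_of_nonneg hθ, abs_of_nonneg (laplaceExponent_nonneg hv')]
          gcongr
          · exact laplaceExponent_le h hv'
          · exact abs_laplaceExponent_sub_le h hv hv'
  linarith

lemma eq_charRoot (h : firstMoment ν < ⊤) (hθ : 0 ≤ θ) (hθm : θ * mass ν < 1) (hs : 0 ≤ s)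
    {v : ℝ} (hv : 0 ≤ v) (e : v = s + θ * laplaceExponent ν v) : v = charRoot ν θ s := by
  have h1 := abs_sub_le_of_char_eq h hθ (hs.trans (le_charRoot h hθ hθm hs)) hv
    (charRoot_eq h hθ hθm hs) e
  rw [sub_self, sub_self, abs_zero, zero_mul, add_zero] at h1
  have h2 : |v - charRoot ν θ s| ≤ 0 := by
    by_contra! h3
    exact absurd h1 (not_le.2 (mul_pos (sub_pos.2 hθm) h3))
  exact sub_eq_zero.1 (abs_nonpos_iff.1 h2)

lemma charRoot_zero_left (h : firstMoment ν < ⊤) (hs : 0 ≤ s) : charRoot ν 0 s = s :=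
  (eq_charRoot h le_rfl (by simp) hs hs (by simp)).symm

lemma charRoot_zero_right (h : firstMoment ν < ⊤) (hθ : 0 ≤ θ) (hθm : θ * mass ν < 1) :
    charRoot ν θ 0 = 0 :=
  (eq_charRoot h hθ hθm le_rfl le_rfl (by simp [laplaceExponent_zero])).symm

lemma charRoot_mono (h : firstMoment ν < ⊤) (hθ : 0 ≤ θ) (hθm : θ * mass ν < 1) :
    MonotoneOn (charRoot ν θ) (Ici 0) := fun s hs t ht hst => by
  by_contra! hlt
  have hs0 := mem_Ici.1 hs
  have ht0 := mem_Ici.1 ht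
  have h1 := mul_le_mul_of_nonneg_left
    (laplaceExponent_sub_le h (ht0.trans (le_charRoot h hθ hθm ht0)) hlt.le) hθ
  have h2 := mul_pos (sub_pos.2 hθm) (sub_pos.2 hlt)
  linarith [charRoot_eq h hθ hθm hs0, charRoot_eq h hθ hθm ht0]

lemma charRoot_sub_le (h : firstMoment ν < ⊤) (hθ : 0 ≤ θ) (hθm : θ * mass ν < 1) {t : ℝ}
    (hs : 0 ≤ s) (ht : 0 ≤ t) :
    |charRoot ν θ t - charRoot ν θ s| ≤ |t - s| / (1 - θ * mass ν) := by
  have h1 := abs_sub_le_of_char_eq h hθ (hs.trans (le_charRoot h hθ hθm hs))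
    (ht.trans (le_charRoot h hθ hθm ht)) (charRoot_eq h hθ hθm hs) (charRoot_eq h hθ hθm ht)
  rw [sub_self θ, abs_zero, zero_mul, add_zero] at h1
  rwa [le_div_iff₀' (sub_pos.2 hθm)]

lemma continuousOn_charRoot (h : firstMoment ν < ⊤) (hθ : 0 ≤ θ) (hθm : θ * mass ν < 1) :
    ContinuousOn (charRoot ν θ) (Ici 0) := by
  have hpos := sub_pos.2 hθm
  refine (LipschitzOnWith.of_dist_le_mul (K := (1 / (1 - θ * mass ν)).toNNReal)
    fun s hs t ht => ?_).continuousOn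
  rw [Real.dist_eq, Real.dist_eq, Real.coe_toNNReal _ (by positivity)]
  exact (charRoot_sub_le h hθ hθm ht hs).trans_eq (by ring)

end

/-- Derivative of an implicitly defined function `v = a + θ φ(v)`. -/
lemma hasDerivAt_of_char_eq {φ a θ v : ℝ → ℝ} {a' θ' φ' r : ℝ} (ha : HasDerivAt a a' r)
    (hθ : HasDerivAt θ θ' r) (hφ : HasDerivAt φ φ' (v r)) (hv : ContinuousAt v r)
    (heq : ∀ᶠ x in 𝓝 r, v x = a x + θ x * φ (v x)) (hne : 1 - θ r * φ' ≠ 0) :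
    HasDerivAt v ((a' + θ' * φ (v r)) / (1 - θ r * φ')) r := by
  -- Subtracting the equations at `x` and `r` gives `slope v · (1 - θ(r) dslope φ) = slope a + slope
  -- θ · φ(v x)`, to be solved for the slope of `v`. Using `dslope` avoids dividing by `v x - v r`,
  -- which may vanish.
  have hd : Tendsto (fun x => dslope φ (v r) (v x)) (𝓝[≠] r) (𝓝 φ') := by
    have h1 := continuousAt_dslope_same.2 hφ.differentiableAt
    have h2 := h1.tendsto.comp (hv.tendsto.mono_left (nhdsWithin_le_nhds (s := {r}ᶜ)))
    rwa [dslope_same, hφ.deriv] at h2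
  have hden : Tendsto (fun x => 1 - θ r * dslope φ (v r) (v x)) (𝓝[≠] r) (𝓝 (1 - θ r * φ')) :=
    (hd.const_mul _).const_sub 1
  have hφv : Tendsto (fun x => φ (v x)) (𝓝[≠] r) (𝓝 (φ (v r))) :=
    (hφ.continuousAt.comp hv).tendsto.mono_left nhdsWithin_le_nhds
  have hnum := (hasDerivAt_iff_tendsto_slope.1 ha).add
    ((hasDerivAt_iff_tendsto_slope.1 hθ).mul hφv)
  rw [hasDerivAt_iff_tendsto_slope]
  refine (hnum.div hden hne).congr' ?_
  filter_upwards [hden.eventually_ne hne, nhdsWithin_le_nhds heq, self_mem_nhdsWithin]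
    with x hx hex hxr
  have hr := heq.self_of_nhds
  have hxr' : x - r ≠ 0 := sub_ne_zero.2 hxr
  have hds : (v x - v r) * dslope φ (v r) (v x) = φ (v x) - φ (v r) := by
    simpa using sub_smul_dslope φ (v r) (v x)
  rw [Pi.div_apply, div_eq_iff hx]
  simp only [slope_def_field]
  field_simp
  linear_combination hr - hex + θ r * hds

/-- The time change `θ(t) = ∫_0^t e^{-mτ} dτ`. -/
noncomputable def timeChange (m t : ℝ) : ℝ := ∫ τ in (0 : ℝ)..t, Real.exp (-(m * τ))

lemma hasDerivAt_timeChange (m t : ℝ) :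
    HasDerivAt (timeChange m) (Real.exp (-(m * t))) t :=
  have hc : Continuous fun τ => Real.exp (-(m * τ)) := by fun_prop
  intervalIntegral.integral_hasDerivAt_right (hc.intervalIntegrable _ _)
    hc.stronglyMeasurable.stronglyMeasurableAtFilter hc.continuousAt

lemma continuous_timeChange (m : ℝ) : Continuous (timeChange m) :=
  continuous_iff_continuousAt.2 fun t => (hasDerivAt_timeChange m t).continuousAt

lemma timeChange_zero (m : ℝ) : timeChange m 0 = 0 := by simp [timeChange]

lemma timeChange_nonneg (m : ℝ) {t : ℝ} (ht : 0 ≤ t) : 0 ≤ timeChange m t :=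
  intervalIntegral.integral_nonneg ht fun _ _ => (Real.exp_pos _).le

/-- Stated as a product to include `m = 0`, where `θ(t) = t`. The contraction factor `θm` thus stays
below one for all times. -/
lemma timeChange_mul (m t : ℝ) : timeChange m t * m = 1 - Real.exp (-(m * t)) := by
  have h : ∀ τ ∈ uIcc 0 t, HasDerivAt (fun τ => -Real.exp (-(m * τ))) (Real.exp (-(m * τ)) * m) τ :=
    fun τ _ => by
      have h1 : HasDerivAt (fun τ : ℝ => -(m * τ)) (-(m * 1)) τ :=
        ((hasDerivAt_id _).const_mul _).neg
      exact h1.exp.neg.congr_deriv (by ring)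
  have := intervalIntegral.integral_eq_sub_of_hasDerivAt h
    (Continuous.intervalIntegrable (by fun_prop) _ _)
  rw [intervalIntegral.integral_mul_const] at this
  rw [timeChange, this]
  rw [mul_zero, neg_zero, Real.exp_zero]
  ring

lemma timeChange_mul_lt (m t : ℝ) : timeChange m t * m < 1 := by
  rw [timeChange_mul]; linarith [Real.exp_pos (-(m * t))]

/-! ### The candidate Laplace exponents and the measures they come from -/

/-- The Laplace exponent at time `t` of the solution with initial value `ν`. -/
noncomputable def evolvedExponent (ν : Measure E) (t s : ℝ) : ℝ :=
  Real.exp (-(mass ν * t)) *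
    laplaceExponent ν (charRoot ν (timeChange (mass ν) t) s)

/-- The derivative of `evolvedExponent ν t` at `s`. -/
noncomputable def evolvedTransform (ν : Measure E) (t s : ℝ) : ℝ :=
  Real.exp (-(mass ν * t)) * massTransform ν (charRoot ν (timeChange (mass ν) t) s) /
    (1 - timeChange (mass ν) t * massTransform ν (charRoot ν (timeChange (mass ν) t) s))

section

variable {ν : Measure E} {t s : ℝ}

lemma evolved_root_nonneg (h : firstMoment ν < ⊤) (ht : 0 ≤ t) (hs : 0 ≤ s) :
    0 ≤ charRoot ν (timeChange (mass ν) t) s :=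
  hs.trans (le_charRoot h (timeChange_nonneg _ ht) (timeChange_mul_lt _ _) hs)

/-- Bounded below by `1 - θm > 0`: characteristics never cross. -/
lemma evolved_denom_pos (h : firstMoment ν < ⊤) (ht : 0 ≤ t) (hs : 0 ≤ s) :
    0 < 1 - timeChange (mass ν) t * massTransform ν (charRoot ν (timeChange (mass ν) t) s) := by
  have h1 := mul_le_mul_of_nonneg_left (massTransform_le_mass h (evolved_root_nonneg h ht hs))
    (timeChange_nonneg (mass ν) ht)
  linarith [timeChange_mul_lt (mass ν) t]

lemma evolvedExponent_zero (h : firstMoment ν < ⊤) (hs : 0 ≤ s) :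
    evolvedExponent ν 0 s = laplaceExponent ν s := by
  simp [evolvedExponent, timeChange_zero, charRoot_zero_left h hs]

lemma hasDerivAt_evolvedExponent (h : firstMoment ν < ⊤) (ht : 0 ≤ t) (hs : 0 < s) :
    HasDerivAt (evolvedExponent ν t) (evolvedTransform ν t s) s := by
  have hθ := timeChange_nonneg (mass ν) ht
  have hθm := timeChange_mul_lt (mass ν) t
  have hroot := hs.trans_le (le_charRoot h hθ hθm hs.le)
  have hφ := hasDerivAt_laplaceExponent h hroot
  have hd := hasDerivAt_of_char_eq (a := fun s => s) (θ := fun _ => timeChange (mass ν) t)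
    (hasDerivAt_id s) (hasDerivAt_const _ _) hφ
    ((continuousOn_charRoot h hθ hθm).continuousAt (Ici_mem_nhds hs))
    ((eventually_gt_nhds hs).mono fun x hx => charRoot_eq h hθ hθm hx.le)
    (evolved_denom_pos h ht hs.le).ne'
  have key : HasDerivAt (evolvedExponent ν t) _ s :=
    (hφ.comp s hd).const_mul (Real.exp (-(mass ν * t)))
  refine key.congr_deriv ?_
  rw [evolvedTransform, zero_mul, add_zero]
  ring

lemma continuousOn_evolved_root (h : firstMoment ν < ⊤) (hs : 0 ≤ s) :
    ContinuousOn (fun t => charRoot ν (timeChange (mass ν) t) s) (Ici 0) := by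
  intro t ht
  have ht' := mem_Ici.1 ht
  rw [ContinuousWithinAt, tendsto_iff_dist_tendsto_zero]
  refine squeeze_zero' (Eventually.of_forall fun _ => dist_nonneg) (g := fun r =>
    |timeChange (mass ν) r - timeChange (mass ν) t| *
      (mass ν * (s / (1 - timeChange (mass ν) r * mass ν))) /
        (1 - timeChange (mass ν) t * mass ν)) ?_ ?_
  · filter_upwards [self_mem_nhdsWithin] with r hr
    have hr' := mem_Ici.1 hr
    have h1 := abs_sub_le_of_char_eq h (timeChange_nonneg (mass ν) ht')
      (evolved_root_nonneg h ht' hs) (evolved_root_nonneg h hr' hs)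
      (charRoot_eq h (timeChange_nonneg _ ht') (timeChange_mul_lt _ _) hs)
      (charRoot_eq h (timeChange_nonneg _ hr') (timeChange_mul_lt _ _) hs)
    rw [sub_self s, abs_zero, zero_add] at h1
    rw [Real.dist_eq, le_div_iff₀' (sub_pos.2 (timeChange_mul_lt _ _))]
    refine h1.trans (mul_le_mul_of_nonneg_left (mul_le_mul_of_nonneg_left ?_ (mass_nonneg ν))
      (abs_nonneg _))
    exact charRoot_le h (timeChange_nonneg _ hr') (timeChange_mul_lt _ _) hs
  · have hc : Continuous fun r => |timeChange (mass ν) r - timeChange (mass ν) t| *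
      (mass ν * (s / (1 - timeChange (mass ν) r * mass ν))) /
        (1 - timeChange (mass ν) t * mass ν) := by
      have := continuous_timeChange (mass ν)
      have hne : ∀ r, 1 - timeChange (mass ν) r * mass ν ≠ 0 := fun r =>
        (sub_pos.2 (timeChange_mul_lt _ _)).ne'
      fun_prop (disch := assumption)
    refine (hc.tendsto' t 0 (by simp)).mono_left nhdsWithin_le_nhds

lemma continuousOn_evolvedExponent (h : firstMoment ν < ⊤) (hs : 0 ≤ s) :
    ContinuousOn (fun t => evolvedExponent ν t s) (Ici 0) := by
  refine ContinuousOn.mul (by fun_prop) ((continuousOn_laplaceExponent h).comp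
    (continuousOn_evolved_root h hs) fun t ht => evolved_root_nonneg h ht hs)

lemma continuousOn_massTransform (h : firstMoment ν < ⊤) :
    ContinuousOn (massTransform ν) (Ioi 0) := fun s hs => by
  have hs' := mem_Ioi.1 hs
  refine ContinuousAt.continuousWithinAt ?_
  rw [ContinuousAt, tendsto_iff_dist_tendsto_zero]
  have hc : Continuous fun r : ℝ => mass ν / (s / 2) * |r - s| := by fun_prop
  refine squeeze_zero' (Eventually.of_forall fun _ => dist_nonneg) ?_ (hc.tendsto' s 0 (by simp))
  filter_upwards [eventually_gt_nhds (half_lt_self hs')] with r hr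
  exact abs_massTransform_sub_le h (half_pos hs') (half_le_self hs'.le) hr.le

lemma continuousOn_evolvedTransform (h : firstMoment ν < ⊤) (hs : 0 < s) :
    ContinuousOn (fun t => evolvedTransform ν t s) (Ici 0) := by
  have h1 : ContinuousOn (fun t => massTransform ν (charRoot ν (timeChange (mass ν) t) s))
      (Ici 0) := (continuousOn_massTransform h).comp (continuousOn_evolved_root h hs.le)
    fun t ht => hs.trans_le (le_charRoot h (timeChange_nonneg _ ht) (timeChange_mul_lt _ _) hs.le)
  have h2 := (continuous_timeChange (mass ν)).continuousOn (s := Ici 0)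
  refine ContinuousOn.div (ContinuousOn.mul (by fun_prop) h1)
    (continuousOn_const.sub (h2.mul h1)) fun t ht => (evolved_denom_pos h ht hs.le).ne'

/-- The damped Burgers equation `∂ₜ u = -u (m - ∂ₛ u)`. -/
lemma hasDerivAt_evolvedExponent_time (h : firstMoment ν < ⊤) (ht : 0 < t) (hs : 0 < s) :
    HasDerivAt (fun t => evolvedExponent ν t s)
      (-(evolvedExponent ν t s * (mass ν - evolvedTransform ν t s))) t := by
  have hroot := hs.trans_le
    (le_charRoot h (timeChange_nonneg (mass ν) ht.le) (timeChange_mul_lt (mass ν) t) hs.le)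
  have hφ := hasDerivAt_laplaceExponent h hroot
  have hd := hasDerivAt_of_char_eq (a := fun _ => s) (θ := timeChange (mass ν))
    (v := fun t => charRoot ν (timeChange (mass ν) t) s)
    (hasDerivAt_const _ _) (hasDerivAt_timeChange _ _) hφ
    ((continuousOn_evolved_root h hs.le).continuousAt (Ici_mem_nhds ht))
    ((eventually_gt_nhds ht).mono fun x hx =>
      charRoot_eq h (timeChange_nonneg _ hx.le) (timeChange_mul_lt _ _) hs.le)
    (evolved_denom_pos h ht.le hs.le).ne'
  have he : HasDerivAt (fun t => Real.exp (-(mass ν * t)))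
      (-(mass ν * Real.exp (-(mass ν * t)))) t := by
    have h1 : HasDerivAt (fun t : ℝ => -(mass ν * t)) (-(mass ν * 1)) t :=
      ((hasDerivAt_id _).const_mul _).neg
    exact h1.exp.congr_deriv (by ring)
  have key : HasDerivAt (fun t => evolvedExponent ν t s) _ t := he.mul
    (HasDerivAt.comp (h := fun t => charRoot ν (timeChange (mass ν) t) s) t hφ hd)
  refine key.congr_deriv ?_
  simp only [evolvedExponent, evolvedTransform]
  have := (evolved_denom_pos h ht.le hs.le).ne'
  field_simp
  ring

lemma evolvedExponent_sub (h : firstMoment ν < ⊤) (ht : 0 ≤ t) (hs : 0 < s) :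
    evolvedExponent ν t s = laplaceExponent ν s +
      ∫ τ in (0 : ℝ)..t, -(evolvedExponent ν τ s * (mass ν - evolvedTransform ν τ s)) := by
  have hc := continuousOn_evolvedExponent h hs.le
  have hc' := continuousOn_evolvedTransform h hs
  have hsub : Icc 0 t ⊆ Ici (0 : ℝ) := Icc_subset_Ici_self
  rw [intervalIntegral.integral_eq_sub_of_hasDerivAt_of_le ht (hc.mono hsub)
    (fun τ hτ => hasDerivAt_evolvedExponent_time h hτ.1 hs), evolvedExponent_zero h hs.le]
  · ring
  · refine ContinuousOn.intervalIntegrable ?_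
    rw [uIcc_of_le ht]
    exact ((hc.mul (continuousOn_const.sub hc')).neg).mono hsub

lemma isBernsteinExponent_evolvedExponent (h : firstMoment ν < ⊤) (ht : 0 ≤ t) :
    IsBernsteinExponent (evolvedExponent ν t) :=
  ((isBernsteinExponent_charRoot h (timeChange_nonneg _ ht)
    (timeChange_mul_lt _ _)).laplaceExponent_comp h
      fun _ hs => evolved_root_nonneg h ht hs).const_mul (Real.exp_pos _).le

lemma monotoneOn_evolvedExponent (h : firstMoment ν < ⊤) (ht : 0 ≤ t) :
    MonotoneOn (evolvedExponent ν t) (Ici 0) := fun _ hs _ hr hsr =>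
  mul_le_mul_of_nonneg_left (laplaceExponent_mono h (evolved_root_nonneg h ht hs)
    (charRoot_mono h (timeChange_nonneg _ ht) (timeChange_mul_lt _ _) hs hr hsr))
    (Real.exp_pos _).le

lemma continuousOn_evolvedExponent_space (h : firstMoment ν < ⊤) (ht : 0 ≤ t) :
    ContinuousOn (evolvedExponent ν t) (Ici 0) :=
  continuousOn_const.mul ((continuousOn_laplaceExponent h).comp
    (continuousOn_charRoot h (timeChange_nonneg _ ht) (timeChange_mul_lt _ _))
    fun _ hs => evolved_root_nonneg h ht hs)

/-- No drift is created: by concavity the increment is at most a constant times `φ'(v(n))`, and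
`v(n) ≥ n` sends this to zero. -/
lemma tendsto_evolvedExponent_increment (h : firstMoment ν < ⊤) (ht : 0 ≤ t) :
    Tendsto (fun n : ℕ => evolvedExponent ν t (n + 1) - evolvedExponent ν t n) atTop (𝓝 0) := by
  have hθ := timeChange_nonneg (mass ν) ht
  have hθm := timeChange_mul_lt (mass ν) t
  have hroot : Tendsto (fun n : ℕ => charRoot ν (timeChange (mass ν) t) n) atTop atTop :=
    tendsto_atTop_mono (fun n => le_charRoot h hθ hθm n.cast_nonneg) tendsto_natCast_atTop_atTop
  refine squeeze_zero (g := fun n : ℕ => Real.exp (-(mass ν * t)) *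
    (massTransform ν (charRoot ν (timeChange (mass ν) t) n) *
      (1 / (1 - timeChange (mass ν) t * mass ν)))) (fun n => ?_) (fun n => ?_) ?_
  · exact sub_nonneg.2 (monotoneOn_evolvedExponent h ht (mem_Ici.2 n.cast_nonneg)
      (mem_Ici.2 (by positivity)) (by linarith))
  · have hn : (0 : ℝ) ≤ n := n.cast_nonneg
    have hmono := charRoot_mono h hθ hθm (mem_Ici.2 hn)
      (mem_Ici.2 (by positivity : (0 : ℝ) ≤ n + 1)) (by linarith)
    have h1 := charRoot_sub_le h hθ hθm hn (by positivity : (0 : ℝ) ≤ n + 1)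
    rw [add_sub_cancel_left, abs_one] at h1
    rw [evolvedExponent, evolvedExponent, ← mul_sub]
    refine mul_le_mul_of_nonneg_left ?_ (Real.exp_pos _).le
    exact (laplaceExponent_sub_le_massTransform h (evolved_root_nonneg h ht hn) hmono).trans
      (mul_le_mul_of_nonneg_left ((le_abs_self _).trans h1) (massTransform_nonneg _))
  · simpa using (((tendsto_massTransform_atTop h).comp hroot).mul_const
      (1 / (1 - timeChange (mass ν) t * mass ν))).const_mul (Real.exp (-(mass ν * t)))

/-- Mass conservation for the explicit formula. With `u` the evolved exponent, `u(s)/s` is squeezed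
between `u'(s)` and `m`: the upper bound uses `φ(v) ≤ mv` and `v ≤ s e^{mt}`, and the lower bound
tends to `m` because `1 - θm = e^{-mt}`. -/
lemma tendsto_mul_evolvedExponent (h : firstMoment ν < ⊤) (ht : 0 ≤ t) :
    Tendsto (fun n : ℕ => (n + 1 : ℝ) * evolvedExponent ν t (1 / (n + 1 : ℝ))) atTop
      (𝓝 (mass ν)) := by
  have hθ := timeChange_nonneg (mass ν) ht
  have hθm := timeChange_mul_lt (mass ν) t
  have hβ : 1 - timeChange (mass ν) t * mass ν = Real.exp (-(mass ν * t)) := by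
    rw [timeChange_mul]; ring
  have hl : Tendsto (fun n : ℕ => 1 / (n + 1 : ℝ)) atTop (𝓝 0) :=
    tendsto_one_div_add_atTop_nhds_zero_nat
  have hroot : Tendsto (fun n : ℕ => charRoot ν (timeChange (mass ν) t) (1 / (n + 1 : ℝ))) atTop
      (𝓝[≥] 0) := by
    have h1 := (continuousOn_charRoot h hθ hθm 0 (by simp)).tendsto.comp
      (tendsto_nhdsWithin_iff.2 ⟨hl, Eventually.of_forall fun n : ℕ =>
        mem_Ici.2 (by positivity : (0 : ℝ) ≤ 1 / (n + 1))⟩)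
    rw [charRoot_zero_right h hθ hθm] at h1
    exact tendsto_nhdsWithin_iff.2 ⟨h1, Eventually.of_forall fun n =>
      evolved_root_nonneg h ht (by positivity)⟩
  have hM := (tendsto_massTransform_zero h).comp hroot
  have hlow : Tendsto (fun n : ℕ => evolvedTransform ν t (1 / (n + 1 : ℝ))) atTop
      (𝓝 (mass ν)) := by
    have h1 := (hM.const_mul (Real.exp (-(mass ν * t)))).div
      ((hM.const_mul (timeChange (mass ν) t)).const_sub 1) (sub_pos.2 hθm).ne'
    rw [hβ, mul_div_cancel_left₀ _ (Real.exp_pos _).ne'] at h1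
    exact h1
  refine tendsto_of_tendsto_of_tendsto_of_le_of_le hlow tendsto_const_nhds (fun n => ?_)
    (fun n => ?_)
  all_goals
    have hn : (0 : ℝ) < n + 1 := by positivity
    have hs : (0 : ℝ) ≤ 1 / (n + 1 : ℝ) := by positivity
    have hv := evolved_root_nonneg h ht hs
    have heq := charRoot_eq h hθ hθm hs
    have hle := charRoot_le h hθ hθm hs
    have hdp := evolved_denom_pos h ht hs
    simp only [evolvedTransform, evolvedExponent]
    set v := charRoot ν (timeChange (mass ν) t) (1 / (n + 1 : ℝ))
  · have h1 := massTransform_mul_le h hv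
    rw [div_le_iff₀ hdp]
    -- Substituting `1/(n+1) = v - θφ(v)` cancels the terms with `θ` and leaves `φ'(v) v ≤ φ(v)`.
    have h3 : massTransform ν v * (1 / (n + 1)) ≤
        laplaceExponent ν v * (1 - timeChange (mass ν) t * massTransform ν v) := by
      nlinarith [massTransform_nonneg (ν := ν) v]
    have h4 := mul_le_mul_of_nonneg_left h3 hn.le
    field_simp at h4
    linarith [mul_le_mul_of_nonneg_left h4 (Real.exp_pos (-(mass ν * t))).le]
  · rw [hβ, div_div, le_div_iff₀ (by positivity)] at hle
    have h1 := mul_le_mul_of_nonneg_left (laplaceExponent_le h hv)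
      (mul_nonneg hn.le (Real.exp_pos (-(mass ν * t))).le)
    have h2 := mul_le_mul_of_nonneg_left hle (mass_nonneg ν)
    linarith

/-- For every `t ≥ 0` the evolved exponent is the Laplace exponent of a measure with the mass of
the initial measure. -/
lemma exists_measure_evolvedExponent (h : firstMoment ν < ⊤) (ht : 0 ≤ t) :
    ∃ μ : Measure E, firstMoment μ = firstMoment ν ∧
      ∀ s, 0 ≤ s → laplaceExponent μ s = evolvedExponent ν t s := by
  obtain ⟨μ, hμ⟩ := (isBernsteinExponent_evolvedExponent h ht).exists_measure
    (by rw [evolvedExponent, charRoot_zero_right h (timeChange_nonneg _ ht) (timeChange_mul_lt _ _),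
      laplaceExponent_zero, mul_zero])
    (monotoneOn_evolvedExponent h ht) (continuousOn_evolvedExponent_space h ht)
    (tendsto_evolvedExponent_increment h ht)
  refine ⟨μ, ?_, fun s hs => (hμ s hs).2⟩
  refine tendsto_nhds_unique (tendsto_ofReal_mul_laplaceExponent fun s hs => (hμ s hs.le).1) ?_
  rw [firstMoment_eq_ofReal_mass h]
  refine ((ENNReal.continuous_ofReal.tendsto _).comp (tendsto_mul_evolvedExponent h ht)).congr
    fun n => ?_
  rw [Function.comp_apply, (hμ _ (by positivity)).2]

lemma massTransform_eq_evolvedTransform {μ : Measure E} (h : firstMoment ν < ⊤) (ht : 0 ≤ t)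
    (hμ : firstMoment μ = firstMoment ν)
    (hμe : ∀ s, 0 ≤ s → laplaceExponent μ s = evolvedExponent ν t s) (hs : 0 < s) :
    massTransform μ s = evolvedTransform ν t s :=
  (hasDerivAt_laplaceExponent (hμ ▸ h) hs).unique
    ((hasDerivAt_evolvedExponent h ht hs).congr_of_eventuallyEq
      ((eventually_gt_nhds hs).mono fun r hr => hμe r (le_of_lt hr)))

end

/-! ### Test functions and their approximation by exponential sums -/

section

variable {f f' : ℝ → ℝ}

lemma isTestFunction_of_hasDerivAt (hf : ∀ x, 0 < x → HasDerivAt f (f' x) x)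
    (hc : ContinuousOn f' (Ioi 0)) (h0 : Tendsto f (𝓝[>] 0) (𝓝 0))
    (hinf : ∃ l, Tendsto f atTop (𝓝 l)) (h0' : ∃ l, Tendsto f' (𝓝[>] 0) (𝓝 l))
    (hb : ∃ C α : ℝ, 0 < α ∧ ∀ x, 0 < x → |f' x| ≤ C * Real.exp (-α * x)) :
    IsTestFunction 1 f := by
  have hd : EqOn (deriv f) f' (Ioi 0) := fun x hx => (hf x hx).deriv
  obtain ⟨C, α, hα, hb⟩ := hb
  have hlim : Tendsto f' atTop (𝓝 0) := by
    have h1 : Tendsto (fun x : ℝ => C * Real.exp (-α * x)) atTop (𝓝 0) := by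
      have h2 : Tendsto (fun x : ℝ => α * x) atTop atTop := tendsto_id.const_mul_atTop hα
      simpa using (Real.tendsto_exp_neg_atTop_nhds_zero.comp h2).const_mul C
    refine squeeze_zero_norm' ?_ h1
    filter_upwards [eventually_gt_atTop 0] with x hx
    exact hb x hx
  refine ⟨⟨?_, fun j hj => ?_⟩, ⟨C, α, hα, fun x hx => ?_⟩, fun j hj => ?_⟩
  · rw [show ((1 : ℕ) : WithTop ℕ∞) = 0 + 1 by norm_num,
      contDiffOn_succ_iff_deriv_of_isOpen isOpen_Ioi]
    refine ⟨fun x hx => (hf x hx).differentiableAt.differentiableWithinAt, by simp, ?_⟩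
    exact contDiffOn_zero.2 (hc.congr hd)
  · interval_cases j
    · simp only [iteratedDeriv_zero]
      exact ⟨⟨0, h0⟩, hinf⟩
    · simp only [iteratedDeriv_one]
      obtain ⟨l, hl⟩ := h0'
      exact ⟨⟨l, hl.congr' (eventually_nhdsWithin_of_forall fun x hx => (hd hx).symm)⟩,
        0, hlim.congr' ((eventually_gt_atTop 0).mono fun x hx => (hd hx).symm)⟩
  · simpa [hd hx] using hb x hx
  · interval_cases j
    simpa using h0

lemma IsTestFunction.hasDerivAt (hf : IsTestFunction 1 f) {x : ℝ} (hx : 0 < x) :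
    HasDerivAt f (deriv f x) x :=
  ((hf.1.1.differentiableOn (by simp)).differentiableAt (Ioi_mem_nhds hx)).hasDerivAt

lemma IsTestFunction.continuousOn_deriv (hf : IsTestFunction 1 f) :
    ContinuousOn (deriv f) (Ioi 0) :=
  hf.1.1.continuousOn_deriv_of_isOpen isOpen_Ioi (by simp)

lemma IsTestFunction.tendsto_zero (hf : IsTestFunction 1 f) : Tendsto f (𝓝[>] 0) (𝓝 0) := by
  simpa using hf.2.2 0 one_pos

lemma IsTestFunction.exists_tendsto_deriv (hf : IsTestFunction 1 f) :
    ∃ l, Tendsto (deriv f) (𝓝[>] 0) (𝓝 l) := by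
  simpa using (hf.1.2 1 le_rfl).1

lemma IsTestFunction.exists_bound (hf : IsTestFunction 1 f) :
    ∃ C α : ℝ, 0 < α ∧ ∀ x : ℝ, 0 < x → |deriv f x| ≤ C * Real.exp (-α * x) := by
  simpa using hf.2.1

end

/-- `f` is `C`-Lipschitz on `(0,∞)` and tends to zero at zero. -/
def IsLipschitzVanishing (C : ℝ) (f : ℝ → ℝ) : Prop :=
  (∀ x, 0 < x → |f x| ≤ C * x) ∧ ∀ x y, 0 < x → 0 < y → |f x - f y| ≤ C * |x - y|

lemma isLipschitzVanishing_of_hasDerivAt {C : ℝ} {f f' : ℝ → ℝ}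
    (hf : ∀ x, 0 < x → HasDerivAt f (f' x) x) (h0 : Tendsto f (𝓝[>] 0) (𝓝 0))
    (hb : ∀ x, 0 < x → |f' x| ≤ C) : IsLipschitzVanishing C f := by
  have h1 : ∀ x y, 0 < x → 0 < y → |f x - f y| ≤ C * |x - y| := fun x y hx hy =>
    (convex_Ioi (0 : ℝ)).norm_image_sub_le_of_norm_hasDerivWithin_le
      (fun z hz => (hf z hz).hasDerivWithinAt) (fun z hz => hb z hz) hy hx
  refine ⟨fun x hx => ?_, h1⟩
  have hc : Tendsto (fun y : ℝ => C * |x - y|) (𝓝[>] 0) (𝓝 (C * |x - 0|)) := by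
    have : Continuous fun y : ℝ => C * |x - y| := by fun_prop
    exact (this.tendsto 0).mono_left nhdsWithin_le_nhds
  have := le_of_tendsto_of_tendsto ((h0.const_sub (f x)).abs) hc
    (eventually_nhdsWithin_of_forall fun y hy => h1 x y hx hy)
  simpa [abs_of_pos hx] using this

namespace IsLipschitzVanishing

variable {C : ℝ} {f : ℝ → ℝ}

lemma nonneg (hf : IsLipschitzVanishing C f) : 0 ≤ C := by
  simpa using (abs_nonneg _).trans (hf.1 1 one_pos)

lemma continuousOn (hf : IsLipschitzVanishing C f) : ContinuousOn f (Ioi 0) :=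
  (LipschitzOnWith.of_dist_le_mul (K := C.toNNReal) fun x hx y hy => by
    rw [Real.coe_toNNReal _ hf.nonneg]
    exact hf.2 x y hx hy).continuousOn

lemma continuous_coe (hf : IsLipschitzVanishing C f) : Continuous fun x : E => f x :=
  hf.continuousOn.comp_continuous continuous_subtype_val fun x => x.2

lemma integrable {ν : Measure E} (hf : IsLipschitzVanishing C f) (h : firstMoment ν < ⊤) :
    Integrable (fun x : E => f x) ν :=
  ((integrable_coe_iff.2 h).const_mul C).mono' hf.continuous_coe.aestronglyMeasurable
    (ae_of_all _ fun x => hf.1 x x.2)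

lemma abs_integral_le {ν : Measure E} (hf : IsLipschitzVanishing C f) (h : firstMoment ν < ⊤) :
    |∫ x : E, f x ∂ν| ≤ C * mass ν := by
  rw [mass, ← integral_const_mul]
  exact norm_integral_le_of_norm_le (f := fun x : E => f x) ((integrable_coe_iff.2 h).const_mul C)
    (ae_of_all _ fun x => hf.1 x x.2)

end IsLipschitzVanishing

lemma IsTestFunction.exists_isLipschitzVanishing {f : ℝ → ℝ} (hf : IsTestFunction 1 f) :
    ∃ C, IsLipschitzVanishing C f := by
  obtain ⟨C, α, hα, hb⟩ := hf.exists_bound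
  refine ⟨|C|, isLipschitzVanishing_of_hasDerivAt (fun x hx => hf.hasDerivAt hx) hf.tendsto_zero
    fun x hx => (hb x hx).trans ?_⟩
  have h1 : Real.exp (-α * x) ≤ 1 := Real.exp_le_one_iff.2 (by nlinarith)
  calc C * Real.exp (-α * x) ≤ |C| * Real.exp (-α * x) := by
        gcongr; exact le_abs_self C
    _ ≤ |C| := mul_le_of_le_one_right (abs_nonneg C) h1

/-- A linear combination of the functions `x ↦ 1 - e^{-kβx}`, `k ≥ 1`, whose derivative is
`e^{-βx} p(e^{-βx})`. -/
noncomputable def expSum (β : ℝ) (p : Polynomial ℝ) (x : ℝ) : ℝ :=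
  ∑ k ∈ p.support, p.coeff k / ((k + 1) * β) * (1 - Real.exp (-((k + 1) * β * x)))

lemma hasDerivAt_one_sub_exp (s x : ℝ) :
    HasDerivAt (fun x => 1 - Real.exp (-(s * x))) (s * Real.exp (-(s * x))) x := by
  have h1 : HasDerivAt (fun x : ℝ => -(s * x)) (-(s * 1)) x :=
    ((hasDerivAt_id _).const_mul _).neg
  exact (h1.exp.const_sub 1).congr_deriv (by ring)

lemma hasDerivAt_expSum {β : ℝ} (hβ : 0 < β) (p : Polynomial ℝ) (x : ℝ) :
    HasDerivAt (expSum β p) (Real.exp (-(β * x)) * p.eval (Real.exp (-(β * x)))) x := by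
  have h1 : HasDerivAt (expSum β p) (∑ k ∈ p.support, p.coeff k / ((k + 1) * β) *
      (((k + 1) * β) * Real.exp (-((k + 1) * β * x)))) x :=
    HasDerivAt.fun_sum fun k _ => (hasDerivAt_one_sub_exp _ x).const_mul _
  refine h1.congr_deriv ?_
  rw [Polynomial.eval_eq_sum, Polynomial.sum, Finset.mul_sum]
  refine Finset.sum_congr rfl fun k _ => ?_
  have h2 : Real.exp (-((k + 1) * β * x)) = Real.exp (-(β * x)) * Real.exp (-(β * x)) ^ k := by
    rw [← Real.exp_nat_mul, ← Real.exp_add]; congr 1; ring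
  have hk : ((k : ℝ) + 1) ≠ 0 := by positivity
  rw [h2]
  field_simp

lemma expSum_zero (β : ℝ) (p : Polynomial ℝ) : expSum β p 0 = 0 := by simp [expSum]

/-- Put `z = e^{-βx}` with `β` half the decay rate. Then `|f'| ≤ C z²`, so `f'/z` extends
continuously to `[0,1]`, with value `0` at `z = 0`, and Weierstrass applies. The factor `z` kept
outside `p` ensures that the antiderivative has no term linear in `x`. -/
lemma IsTestFunction.exists_polynomial_near_deriv {f : ℝ → ℝ} (hf : IsTestFunction 1 f) {ε : ℝ}
    (hε : 0 < ε) : ∃ β, 0 < β ∧ ∃ p : Polynomial ℝ, ∀ x, 0 < x →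
      |deriv f x - Real.exp (-(β * x)) * p.eval (Real.exp (-(β * x)))| ≤ ε := by
  obtain ⟨C, α, hα, hb⟩ := hf.exists_bound
  obtain ⟨l, hl⟩ := hf.exists_tendsto_deriv
  set β := α / 2 with hβdef
  have hβ : 0 < β := half_pos hα
  let g : ℝ → ℝ := fun z => z⁻¹ * deriv f (-Real.log z / β)
  have hx : ∀ z, 0 < z → z < 1 → 0 < -Real.log z / β := fun z h0 h1 =>
    div_pos (neg_pos.2 (Real.log_neg h0 h1)) hβ
  have hgc : ContinuousOn g (Ioo 0 1) := by
    refine ContinuousOn.mul (continuousOn_inv₀.mono fun z hz => hz.1.ne')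
      (hf.continuousOn_deriv.comp ?_ fun z hz => hx z hz.1 hz.2)
    exact ((Real.continuousOn_log.mono fun z hz => hz.1.ne').neg).div_const β
  have hg0 : Tendsto g (𝓝[>] 0) (𝓝 0) := by
    have h1 : Tendsto (fun z : ℝ => C * z) (𝓝[>] 0) (𝓝 0) := by
      have : Continuous fun z : ℝ => C * z := by fun_prop
      exact (this.tendsto' 0 0 (by simp)).mono_left nhdsWithin_le_nhds
    refine squeeze_zero_norm' ?_ h1
    filter_upwards [Ioo_mem_nhdsGT one_pos] with z hz
    have h2 := hb _ (hx z hz.1 hz.2)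
    have h3 : Real.exp (-α * (-Real.log z / β)) = z ^ 2 := by
      rw [show -α * (-Real.log z / β) = (2 : ℕ) * Real.log z by
        rw [hβdef]; push_cast; field_simp, Real.exp_nat_mul, Real.exp_log hz.1]
    rw [h3] at h2
    rw [norm_mul, norm_inv, Real.norm_of_nonneg hz.1.le, Real.norm_eq_abs,
      inv_mul_le_iff₀ hz.1]
    exact h2.trans_eq (by ring)
  have hg1 : Tendsto g (𝓝[<] 1) (𝓝 l) := by
    have h1 : Tendsto (fun z : ℝ => -Real.log z / β) (𝓝[<] 1) (𝓝[>] 0) := by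
      refine tendsto_nhdsWithin_iff.2 ⟨?_, ?_⟩
      · have h2 : ContinuousAt (fun z : ℝ => -Real.log z / β) 1 :=
          ((Real.continuousAt_log one_ne_zero).neg).div_const β
        have h3 := h2.tendsto
        simp only [Real.log_one, neg_zero, zero_div] at h3
        exact h3.mono_left nhdsWithin_le_nhds
      · filter_upwards [Ioo_mem_nhdsLT (zero_lt_one (α := ℝ))] with z hz
        exact hx z hz.1 hz.2
    have h4 : Tendsto (fun z : ℝ => z⁻¹) (𝓝[<] 1) (𝓝 1) := by
      have := (continuousAt_inv₀ (one_ne_zero (α := ℝ))).tendsto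
      rw [inv_one] at this
      exact this.mono_left nhdsWithin_le_nhds
    simpa using h4.mul (hl.comp h1)
  have hH := continuousOn_Icc_extendFrom_Ioo hgc hg0 hg1
  obtain ⟨p, hp⟩ := exists_polynomial_near_of_continuousOn 0 1 _ hH ε hε
  refine ⟨β, hβ, p, fun x hx => ?_⟩
  have hz0 : 0 < Real.exp (-(β * x)) := Real.exp_pos _
  have hz1 : Real.exp (-(β * x)) < 1 := Real.exp_lt_one_iff.2 (by linarith [mul_pos hβ hx])
  have h1 := hp _ ⟨hz0.le, hz1.le⟩
  rw [extendFrom_extends hgc _ ⟨hz0, hz1⟩] at h1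
  have h2 : -Real.log (Real.exp (-(β * x))) / β = x := by
    rw [Real.log_exp, neg_neg, mul_div_cancel_left₀ _ hβ.ne']
  simp only [g, h2] at h1
  have h3 : deriv f x - Real.exp (-(β * x)) * p.eval (Real.exp (-(β * x))) =
      -(Real.exp (-(β * x)) * (p.eval (Real.exp (-(β * x))) -
        (Real.exp (-(β * x)))⁻¹ * deriv f x)) := by
    field_simp; ring
  rw [h3, abs_neg, abs_mul, abs_of_pos hz0]
  calc _ ≤ 1 * ε := mul_le_mul hz1.le h1.le (abs_nonneg _) zero_le_one
    _ = ε := one_mul ε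

/-- Test functions are approximated, with uniformly close derivatives, by exponential sums. -/
theorem IsTestFunction.exists_expSum {f : ℝ → ℝ} (hf : IsTestFunction 1 f) {ε : ℝ} (hε : 0 < ε) :
    ∃ β, 0 < β ∧ ∃ p : Polynomial ℝ, IsLipschitzVanishing ε fun x => f x - expSum β p x := by
  obtain ⟨β, hβ, p, hp⟩ := hf.exists_polynomial_near_deriv hε
  refine ⟨β, hβ, p, isLipschitzVanishing_of_hasDerivAt
    (fun x hx => (hf.hasDerivAt hx).sub (hasDerivAt_expSum hβ p x)) ?_ hp⟩
  have h1 : ContinuousAt (expSum β p) 0 := (hasDerivAt_expSum hβ p 0).continuousAt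
  have h2 := h1.tendsto.mono_left (nhdsWithin_le_nhds (s := Ioi 0))
  rw [expSum_zero] at h2
  simpa using hf.tendsto_zero.sub h2

/-! ### The coagulation pairing -/

lemma isFiniteMeasureOnCompacts_of_firstMoment {ν : Measure E} (h : firstMoment ν < ⊤) :
    IsFiniteMeasureOnCompacts ν := ⟨fun K hK => by
  rcases K.eq_empty_or_nonempty with rfl | hne
  · simp
  obtain ⟨a, -, hmin⟩ := hK.exists_isMinOn hne
    (continuous_subtype_val (p := (· ∈ Ioi (0 : ℝ)))).continuousOn
  exact (measure_mono fun x hx => hmin hx).trans_lt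
    ((integrable_coe_iff.2 h).measure_ge_lt_top (mem_Ioi.1 a.2))⟩

lemma sigmaFinite_of_isFiniteMeasureOnCompacts (ν : Measure E) [IsFiniteMeasureOnCompacts ν] :
    SigmaFinite ν :=
  have : LocallyCompactSpace E := isOpen_Ioi.locallyCompactSpace
  inferInstance

/-- The integrand of the coagulation pairing with the additive kernel. -/
noncomputable def coagIntegrand (f : ℝ → ℝ) (p : E × E) : ℝ :=
  (f ((p.1 : ℝ) + p.2) - f p.1 - f p.2) * ((p.1 : ℝ) + p.2)

lemma coagPairing_eq (f : ℝ → ℝ) (ν : Measure E) :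
    coagPairing additiveKernel f ν = (1 / 2) * ∫ p, coagIntegrand f p ∂ν.prod ν := rfl

section

variable {f g : ℝ → ℝ} {C : ℝ} {ν : Measure E}

/-- The bracket is at most `2C min(x, y)`, and `min(x, y)(x + y) ≤ 2xy`. Hence pairings are
controlled by the squared mass alone. -/
lemma IsLipschitzVanishing.abs_coagIntegrand_le (hf : IsLipschitzVanishing C f) (p : E × E) :
    |coagIntegrand f p| ≤ 4 * C * ((p.1 : ℝ) * p.2) := by
  obtain ⟨⟨x, hx⟩, y, hy⟩ := p
  have hx := mem_Ioi.1 hx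
  have hy := mem_Ioi.1 hy
  simp only [coagIntegrand]
  have e1 : |f (x + y) - f x - f y| ≤ 2 * C * y := by
    have h1 := hf.2 (x + y) x (by positivity) hx
    rw [add_sub_cancel_left, abs_of_pos hy] at h1
    linarith [abs_sub (f (x + y) - f x) (f y), hf.1 y hy]
  have e2 : |f (x + y) - f x - f y| ≤ 2 * C * x := by
    have h1 := hf.2 (x + y) y (by positivity) hy
    rw [add_sub_cancel_right, abs_of_pos hx] at h1
    have h2 : f (x + y) - f x - f y = f (x + y) - f y - f x := by ring
    rw [h2]
    linarith [abs_sub (f (x + y) - f y) (f x), hf.1 x hx]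
  rw [abs_mul, abs_of_pos (add_pos hx hy)]
  nlinarith

lemma IsLipschitzVanishing.continuous_coagIntegrand (hf : IsLipschitzVanishing C f) :
    Continuous (coagIntegrand f) := by
  have h1 : Continuous fun p : E × E => f ((p.1 : ℝ) + p.2) :=
    hf.continuousOn.comp_continuous (by fun_prop)
      fun p => add_pos (mem_Ioi.1 p.1.2) (mem_Ioi.1 p.2.2)
  exact ((h1.sub (hf.continuous_coe.comp continuous_fst)).sub
    (hf.continuous_coe.comp continuous_snd)).mul (by fun_prop)

lemma integrable_mul_coe (h : firstMoment ν < ⊤) :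
    Integrable (fun p : E × E => (p.1 : ℝ) * p.2) (ν.prod ν) :=
  (integrable_coe_iff.2 h).mul_prod (integrable_coe_iff.2 h)

lemma IsLipschitzVanishing.integrable_coagIntegrand (hf : IsLipschitzVanishing C f)
    (h : firstMoment ν < ⊤) : Integrable (coagIntegrand f) (ν.prod ν) :=
  ((integrable_mul_coe h).const_mul (4 * C)).mono'
    hf.continuous_coagIntegrand.aestronglyMeasurable (ae_of_all _ hf.abs_coagIntegrand_le)

lemma IsLipschitzVanishing.coagPairing_sub {D : ℝ} (hf : IsLipschitzVanishing C f)
    (hg : IsLipschitzVanishing D g) (h : firstMoment ν < ⊤) :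
    coagPairing additiveKernel (fun x => f x - g x) ν =
      coagPairing additiveKernel f ν - coagPairing additiveKernel g ν := by
  rw [coagPairing_eq, coagPairing_eq, coagPairing_eq, ← mul_sub,
    ← integral_sub (hf.integrable_coagIntegrand h) (hg.integrable_coagIntegrand h)]
  congr 2
  ext p
  simp only [coagIntegrand]
  ring

lemma coagPairing_sum {ι : Type*} (T : Finset ι) (c : ι → ℝ) {e : ι → ℝ → ℝ} {D : ι → ℝ}
    (he : ∀ i, IsLipschitzVanishing (D i) (e i)) (h : firstMoment ν < ⊤) :
    coagPairing additiveKernel (fun x => ∑ i ∈ T, c i * e i x) ν =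
      ∑ i ∈ T, c i * coagPairing additiveKernel (e i) ν := by
  have h1 : coagIntegrand (fun x => ∑ i ∈ T, c i * e i x) =
      fun p => ∑ i ∈ T, c i * coagIntegrand (e i) p := by
    ext p
    simp only [coagIntegrand, ← Finset.sum_sub_distrib, Finset.sum_mul]
    exact Finset.sum_congr rfl fun i _ => by ring
  rw [coagPairing_eq, h1, integral_finsetSum _ fun i _ =>
    ((he i).integrable_coagIntegrand h).const_mul (c i), Finset.mul_sum]
  refine Finset.sum_congr rfl fun i _ => ?_
  rw [integral_const_mul, coagPairing_eq]
  ring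

lemma isLipschitzVanishing_one_sub_exp {s : ℝ} (hs : 0 ≤ s) :
    IsLipschitzVanishing s fun x => 1 - Real.exp (-(s * x)) := by
  refine isLipschitzVanishing_of_hasDerivAt (fun x _ => hasDerivAt_one_sub_exp s x) ?_
    fun x hx => ?_
  · have : Continuous fun x : ℝ => 1 - Real.exp (-(s * x)) := by fun_prop
    exact (this.tendsto' 0 0 (by simp)).mono_left nhdsWithin_le_nhds
  · rw [abs_of_nonneg (by positivity)]
    exact mul_le_of_le_one_right hs (Real.exp_le_one_iff.2 (by linarith [mul_nonneg hs hx.le]))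

variable [SFinite ν]

lemma IsLipschitzVanishing.abs_coagPairing_le (hf : IsLipschitzVanishing C f)
    (h : firstMoment ν < ⊤) : |coagPairing additiveKernel f ν| ≤ 2 * C * mass ν ^ 2 := by
  have h1 : |∫ p, coagIntegrand f p ∂ν.prod ν| ≤ 4 * C * (mass ν * mass ν) := by
    rw [mass, ← integral_prod_mul, ← integral_const_mul]
    exact norm_integral_le_of_norm_le (f := coagIntegrand f)
      ((integrable_mul_coe h).const_mul (4 * C))
      (ae_of_all _ hf.abs_coagIntegrand_le)
  rw [coagPairing_eq, abs_mul, abs_of_pos (by norm_num : (0 : ℝ) < 1 / 2)]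
  linarith

/-- With `e(x) = 1 - e^{-sx}` the bracket is `-e(x)e(y)`, so the integrand is a sum of two products
of one-variable functions. The value is the right-hand side of the damped Burgers equation. -/
lemma coagPairing_one_sub_exp (h : firstMoment ν < ⊤) {s : ℝ} (hs : 0 ≤ s) :
    coagPairing additiveKernel (fun x => 1 - Real.exp (-(s * x))) ν =
      -(laplaceExponent ν s * (mass ν - massTransform ν s)) := by
  have i1 := integrable_one_sub_exp h hs
  have i2 : Integrable (fun x : E => (x : ℝ) - x * Real.exp (-(s * x))) ν :=
    (integrable_coe_iff.2 h).sub (integrable_mul_exp h hs)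
  have h1 : coagIntegrand (fun x => 1 - Real.exp (-(s * x))) = fun p : E × E =>
      -(((p.1 : ℝ) - p.1 * Real.exp (-(s * p.1))) * (1 - Real.exp (-(s * p.2))) +
        (1 - Real.exp (-(s * p.1))) * ((p.2 : ℝ) - p.2 * Real.exp (-(s * p.2)))) := by
    ext p
    have e : Real.exp (-(s * ((p.1 : ℝ) + p.2))) =
        Real.exp (-(s * p.1)) * Real.exp (-(s * p.2)) := by
      rw [← Real.exp_add]; congr 1; ring
    simp only [coagIntegrand, e]
    ring
  have h2 : ∫ x : E, ((x : ℝ) - x * Real.exp (-(s * x))) ∂ν = mass ν - massTransform ν s :=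
    integral_sub (integrable_coe_iff.2 h) (integrable_mul_exp h hs)
  rw [coagPairing_eq, h1, integral_neg, integral_add (i2.mul_prod i1) (i1.mul_prod i2),
    integral_prod_mul (fun x : E => (x : ℝ) - x * Real.exp (-(s * x)))
      (fun x : E => 1 - Real.exp (-(s * x))),
    integral_prod_mul (fun x : E => 1 - Real.exp (-(s * x)))
      (fun x : E => (x : ℝ) - x * Real.exp (-(s * x))), h2, ← laplaceExponent]
  ring

end

/-! ### Laplace exponents determine the measure -/

lemma isTestFunction_of_contDiff_of_hasCompactSupport {f : ℝ → ℝ} (hf : ContDiff ℝ 1 f)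
    {a b : ℝ} (ha : 0 < a) (hab : ∀ x, x ∉ Icc a b → f x = 0) : IsTestFunction 1 f := by
  have hd : ∀ x, x ∉ Icc a b → deriv f x = 0 := fun x hx => by
    have : f =ᶠ[𝓝 x] fun _ => 0 :=
      (isClosed_Icc.isOpen_compl.eventually_mem hx).mono fun y hy => hab y hy
    rw [this.deriv_eq, deriv_const]
  have hnear : ∀ᶠ x in 𝓝[>] (0 : ℝ), x ∉ Icc a b :=
    nhdsWithin_le_nhds ((eventually_lt_nhds ha).mono fun x hx h => absurd h.1 (not_le.2 hx))
  have hfar : ∀ᶠ x in atTop, x ∉ Icc a b :=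
    (eventually_gt_atTop b).mono fun x hx h => absurd h.2 (not_le.2 hx)
  have hdc : Continuous (deriv f) := hf.continuous_deriv le_rfl
  obtain ⟨M, hM⟩ := isCompact_Icc.exists_bound_of_continuousOn (hdc.continuousOn (s := Icc a b))
  refine isTestFunction_of_hasDerivAt (f' := deriv f)
    (fun x _ => (hf.differentiable one_ne_zero x).hasDerivAt) hdc.continuousOn
    (tendsto_const_nhds.congr' (hnear.mono fun x hx => (hab x hx).symm))
    ⟨0, tendsto_const_nhds.congr' (hfar.mono fun x hx => (hab x hx).symm)⟩
    ⟨0, tendsto_const_nhds.congr' (hnear.mono fun x hx => (hd x hx).symm)⟩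
    -- Rate `1` works since `e^{b - x} ≥ 1` on `[a, b]` and the derivative vanishes elsewhere.
    ⟨|M| * Real.exp b, 1, one_pos, fun x hx => ?_⟩
  by_cases h : x ∈ Icc a b
  · calc |deriv f x| ≤ |M| * 1 := by rw [mul_one]; exact (hM x h).trans (le_abs_self M)
      _ ≤ |M| * Real.exp (b - x) := by
        gcongr; exact Real.one_le_exp (sub_nonneg.2 h.2)
      _ = _ := by rw [mul_assoc, ← Real.exp_add]; congr 2; ring
  · rw [hd x h, abs_zero]; positivity

/-- The indicator of a compact set is a pointwise limit of a bounded sequence of test functions. -/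
lemma exists_isTestFunction_tendsto_indicator {B : Set E} (hB : IsCompact B) :
    ∃ F : ℕ → ℝ → ℝ, (∀ n, IsTestFunction 1 (F n)) ∧ ∀ ν : Measure E, firstMoment ν < ⊤ →
      Tendsto (fun n => ENNReal.ofReal (∫ x : E, F n x ∂ν)) atTop (𝓝 (ν B)) := by
  have hK : IsCompact (Subtype.val '' B) := hB.image continuous_subtype_val
  obtain ⟨c, hc, d, hcd⟩ : ∃ c, 0 < c ∧ ∃ d, Subtype.val '' B ⊆ Icc c d := by
    obtain ⟨d, hd⟩ := hK.bddAbove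
    rcases B.eq_empty_or_nonempty with rfl | hne
    · exact ⟨1, one_pos, 1, by simp⟩
    · obtain ⟨x, hx, hmin⟩ := hK.exists_isLeast (hne.image _)
      obtain ⟨y, -, rfl⟩ := hx
      exact ⟨y, y.2, d, fun z hz => ⟨hmin hz, hd hz⟩⟩
  -- A bump equal to `1` exactly on the compact set: its powers decrease to the indicator. The
  -- exponents `n + 1` start at one because the zeroth power is not a test function.
  obtain ⟨f, hf, hr, hf0, hf1⟩ := exists_contMDiff_zero_iff_one_iff_of_isClosed
    (modelWithCornersSelf ℝ ℝ) (n := 1) (s := (Ioo (c / 2) (d + 1))ᶜ) (t := Subtype.val '' B)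
    isOpen_Ioo.isClosed_compl hK.isClosed
    (disjoint_compl_left_iff_subset.2 fun x hx =>
      ⟨by linarith [(hcd hx).1], by linarith [(hcd hx).2]⟩)
  have hfz : ∀ x, x ∉ Icc (c / 2) (d + 1) → f x = 0 := fun x hx =>
    (hf0 x).1 fun h => hx (Ioo_subset_Icc_self h)
  have hf01 : ∀ x, 0 ≤ f x ∧ f x ≤ 1 := fun x => hr (mem_range_self x)
  have hF : ∀ n : ℕ, IsTestFunction 1 fun x => f x ^ (n + 1) := fun n =>
    isTestFunction_of_contDiff_of_hasCompactSupport (hf.contDiff.pow _) (half_pos hc)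
      fun x hx => by rw [hfz x hx, zero_pow n.succ_ne_zero]
  refine ⟨fun n x => f x ^ (n + 1), hF, fun ν hν => ?_⟩
  have hfin := isFiniteMeasureOnCompacts_of_firstMoment hν
  rw [← ENNReal.ofReal_toReal hB.measure_lt_top.ne]
  refine (ENNReal.continuous_ofReal.tendsto _).comp ?_
  change Tendsto _ _ (𝓝 (ν.real B))
  rw [← integral_indicator_one hB.measurableSet]
  have hint : ∀ n : ℕ, Integrable (fun x : E => f x ^ (n + 1)) ν := fun n => by
    obtain ⟨C, hC⟩ := (hF n).exists_isLipschitzVanishing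
    exact hC.integrable hν
  refine tendsto_integral_of_dominated_convergence (fun x : E => f x)
    (fun n => (hint n).aestronglyMeasurable) (by simpa using hint 0)
    (fun n => ae_of_all _ fun x => ?_) (ae_of_all _ fun x => ?_)
  · rw [Real.norm_of_nonneg (pow_nonneg (hf01 x).1 _)]
    exact pow_le_of_le_one (hf01 x).1 (hf01 x).2 n.succ_ne_zero
  · by_cases hx : x ∈ B
    · have : f x = 1 := (hf1 x).1 (mem_image_of_mem _ hx)
      simp [hx, this]
    · have : f x < 1 := lt_of_le_of_ne (hf01 x).2 fun h => hx (by
        obtain ⟨y, hy, hyx⟩ := (hf1 x).2 h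
        rwa [← Subtype.ext hyx])
      simpa [hx] using (tendsto_add_atTop_iff_nat 1).2
        (tendsto_pow_atTop_nhds_zero_of_lt_one (hf01 x).1 this)

/-- Test functions see the measure of compact sets, and regularity carries the equality to open sets
and then to all Borel sets. -/
lemma ext_of_forall_integral_isTestFunction {μ ν : Measure E} (hμ : firstMoment μ < ⊤)
    (hν : firstMoment ν < ⊤)
    (h : ∀ f, IsTestFunction 1 f → ∫ x : E, f x ∂μ = ∫ x : E, f x ∂ν) : μ = ν := by
  have hμ' := isFiniteMeasureOnCompacts_of_firstMoment hμ
  have hν' := isFiniteMeasureOnCompacts_of_firstMoment hν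
  have : LocallyCompactSpace E := isOpen_Ioi.locallyCompactSpace
  have hK : ∀ K : Set E, IsCompact K → μ K = ν K := fun K hK => by
    obtain ⟨F, hF, hlim⟩ := exists_isTestFunction_tendsto_indicator hK
    refine tendsto_nhds_unique (hlim μ hμ) ?_
    simpa only [h _ (hF _)] using hlim ν hν
  refine Measure.OuterRegular.ext_isOpen fun U hU => ?_
  rw [hU.measure_eq_iSup_isCompact, hU.measure_eq_iSup_isCompact]
  exact iSup_congr fun K => iSup_congr fun _ => iSup_congr fun hc => hK K hc

/-- A measure on `(0,∞)` with finite first moment is determined by its Laplace exponent. -/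
theorem ext_of_laplaceExponent_eq {μ ν : Measure E} (hμ : firstMoment μ < ⊤)
    (hν : firstMoment ν < ⊤) (h : ∀ s, 0 < s → laplaceExponent μ s = laplaceExponent ν s) :
    μ = ν := by
  refine ext_of_forall_integral_isTestFunction hμ hν fun f hf => ?_
  have hexp : ∀ β, 0 < β → ∀ p, ∫ x : E, expSum β p x ∂μ = ∫ x : E, expSum β p x ∂ν :=
    fun β hβ p => by
      have hk : ∀ k : ℕ, 0 < ((k : ℝ) + 1) * β := fun k => by positivity
      simp only [expSum]
      rw [integral_finsetSum _ fun k _ => (integrable_one_sub_exp hμ (hk k).le).const_mul _,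
        integral_finsetSum _ fun k _ => (integrable_one_sub_exp hν (hk k).le).const_mul _]
      refine Finset.sum_congr rfl fun k _ => ?_
      rw [integral_const_mul, integral_const_mul]
      exact congrArg _ (h _ (hk k))
  obtain ⟨C, hC⟩ := hf.exists_isLipschitzVanishing
  have hle : ∀ ε, 0 < ε →
      |∫ x : E, f x ∂μ - ∫ x : E, f x ∂ν| ≤ ε * (mass μ + mass ν) := fun ε hε => by
    obtain ⟨β, hβ, p, hp⟩ := hf.exists_expSum hε
    have hs : ∀ lam : Measure E, firstMoment lam < ⊤ →
        ∫ x : E, f x ∂lam = ∫ x : E, (f x - expSum β p x) ∂lam + ∫ x : E, expSum β p x ∂lam :=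
      fun lam hl => by
        have i1 := hC.integrable hl
        have i2 := hp.integrable hl
        have i3 : Integrable (fun x : E => expSum β p x) lam :=
          (i1.sub i2).congr (ae_of_all _ fun x => by simp)
        rw [← integral_add i2 i3]
        simp
    rw [hs μ hμ, hs ν hν, hexp β hβ p, add_sub_add_right_eq_sub]
    refine (abs_sub _ _).trans ?_
    linarith [hp.abs_integral_le hμ, hp.abs_integral_le hν]
  have hlim : Tendsto (fun ε : ℝ => ε * (mass μ + mass ν)) (𝓝[>] 0) (𝓝 0) := by
    have : Continuous fun ε : ℝ => ε * (mass μ + mass ν) := by fun_prop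
    exact (this.tendsto' 0 0 (by simp)).mono_left nhdsWithin_le_nhds
  exact sub_eq_zero.1 (abs_nonpos_iff.1
    (ge_of_tendsto hlim (eventually_nhdsWithin_of_forall fun ε hε => hle ε hε)))

/-! ### Measures with the evolved Laplace exponents solve the equation -/

lemma mass_eq_of_firstMoment_eq {μ ν : Measure E} (h : firstMoment ν < ⊤)
    (hμ : firstMoment μ = firstMoment ν) : mass μ = mass ν := by
  have h' : firstMoment μ < ⊤ := hμ ▸ h
  rw [firstMoment_eq_ofReal_mass h, firstMoment_eq_ofReal_mass h'] at hμ
  exact (ENNReal.ofReal_eq_ofReal_iff (mass_nonneg _) (mass_nonneg _)).1 hμ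

lemma hasDerivWithinAt_of_eq_primitive {F P : ℝ → ℝ} (hP : ContinuousOn P (Ici 0))
    (h : ∀ t, 0 ≤ t → F t = F 0 + ∫ τ in (0 : ℝ)..t, P τ) {t : ℝ} (ht : 0 ≤ t) :
    HasDerivWithinAt F (P t) (Ici 0) t := by
  -- Freezing `P` at its value at zero for negative times makes the fundamental theorem of calculus
  -- available at `t = 0` too.
  have hc : Continuous fun τ => P (max 0 τ) :=
    hP.comp_continuous (by fun_prop) fun τ => le_max_left 0 τ
  have h1 : HasDerivAt (fun t => F 0 + ∫ τ in (0 : ℝ)..t, P (max 0 τ)) (P (max 0 t)) t :=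
    (intervalIntegral.integral_hasDerivAt_right (hc.intervalIntegrable _ _)
      hc.stronglyMeasurable.stronglyMeasurableAtFilter hc.continuousAt).const_add _
  rw [max_eq_right ht] at h1
  have heq : ∀ r, 0 ≤ r → F r = F 0 + ∫ τ in (0 : ℝ)..r, P (max 0 τ) := fun r hr => by
    rw [h r hr]
    congr 1
    refine intervalIntegral.integral_congr fun τ hτ => ?_
    rw [uIcc_of_le hr] at hτ
    rw [max_eq_right hτ.1]
  exact h1.hasDerivWithinAt.congr heq (heq t ht)

lemma continuousOn_of_eq_primitive {F P : ℝ → ℝ}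
    (hP : ∀ t, 0 ≤ t → IntervalIntegrable P volume 0 t)
    (h : ∀ t, 0 ≤ t → F t = F 0 + ∫ τ in (0 : ℝ)..t, P τ) : ContinuousOn F (Ici 0) := by
  intro t ht
  have ht' := mem_Ici.1 ht
  have h0 := (intervalIntegral.continuousOn_primitive_interval' (hP (t + 1) (by positivity))
    left_mem_uIcc).const_add (F 0)
  rw [uIcc_of_le (by positivity)] at h0
  have h1 : ContinuousOn F (Icc 0 (t + 1)) := h0.congr fun r hr => h r hr.1
  refine (h1 t ⟨ht', by linarith⟩).mono_of_mem_nhdsWithin ?_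
  rw [← Ici_inter_Iic]
  exact inter_mem self_mem_nhdsWithin (nhdsWithin_le_nhds (Iic_mem_nhds (by linarith)))

section

variable {ν₀ : Measure E} {ν : ℝ → Measure E}

lemma coagPairing_one_sub_exp_evolved (h : firstMoment ν₀ < ⊤)
    (h1 : ∀ t, 0 ≤ t → firstMoment (ν t) = firstMoment ν₀)
    (h2 : ∀ t, 0 ≤ t → ∀ s, 0 ≤ s → laplaceExponent (ν t) s = evolvedExponent ν₀ t s)
    {s t : ℝ} (hs : 0 < s) (ht : 0 ≤ t) :
    coagPairing additiveKernel (fun x => 1 - Real.exp (-(s * x))) (ν t) =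
      -(evolvedExponent ν₀ t s * (mass ν₀ - evolvedTransform ν₀ t s)) := by
  have hfin : firstMoment (ν t) < ⊤ := h1 t ht ▸ h
  have := isFiniteMeasureOnCompacts_of_firstMoment hfin
  have := sigmaFinite_of_isFiniteMeasureOnCompacts (ν t)
  rw [coagPairing_one_sub_exp hfin hs.le, h2 t ht s hs.le, mass_eq_of_firstMoment_eq h (h1 t ht),
    massTransform_eq_evolvedTransform h ht (h1 t ht) (h2 t ht) hs]

/-- By linearity this is the integrated Burgers equation term by term. Continuity in time is
included because it passes to uniform limits and yields integrability there. -/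
lemma expSum_weak_eq (h : firstMoment ν₀ < ⊤)
    (h1 : ∀ t, 0 ≤ t → firstMoment (ν t) = firstMoment ν₀)
    (h2 : ∀ t, 0 ≤ t → ∀ s, 0 ≤ s → laplaceExponent (ν t) s = evolvedExponent ν₀ t s)
    {β : ℝ} (hβ : 0 < β) (p : Polynomial ℝ) :
    ContinuousOn (fun τ => coagPairing additiveKernel (expSum β p) (ν τ)) (Ici 0) ∧
      ∀ t, 0 ≤ t → ∫ x : E, expSum β p x ∂(ν t) = (∫ x : E, expSum β p x ∂(ν 0)) +
        ∫ τ in (0 : ℝ)..t, coagPairing additiveKernel (expSum β p) (ν τ) := by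
  have hk : ∀ k : ℕ, 0 < ((k : ℝ) + 1) * β := fun k => by positivity
  let P : ℕ → ℝ → ℝ := fun k τ =>
    -(evolvedExponent ν₀ τ ((k + 1) * β) * (mass ν₀ - evolvedTransform ν₀ τ ((k + 1) * β)))
  have hPc : ∀ k, ContinuousOn (P k) (Ici 0) := fun k =>
    ((continuousOn_evolvedExponent h (hk k).le).mul
      (continuousOn_const.sub (continuousOn_evolvedTransform h (hk k)))).neg
  have hpair : ∀ τ, 0 ≤ τ → coagPairing additiveKernel (expSum β p) (ν τ) =
      ∑ k ∈ p.support, p.coeff k / ((k + 1) * β) * P k τ := fun τ hτ => by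
    have hfin : firstMoment (ν τ) < ⊤ := h1 τ hτ ▸ h
    refine (coagPairing_sum p.support _
      (fun k : ℕ => isLipschitzVanishing_one_sub_exp (hk k).le) hfin).trans ?_
    exact Finset.sum_congr rfl fun k _ => by
      rw [coagPairing_one_sub_exp_evolved h h1 h2 (hk k) hτ]
  have hint : ∀ τ, 0 ≤ τ → ∫ x : E, expSum β p x ∂(ν τ) =
      ∑ k ∈ p.support, p.coeff k / ((k + 1) * β) * evolvedExponent ν₀ τ ((k + 1) * β) :=
    fun τ hτ => by
      simp only [expSum]
      rw [integral_finsetSum _ fun k _ =>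
        (integrable_one_sub_exp (h1 τ hτ ▸ h) (hk k).le).const_mul _]
      refine Finset.sum_congr rfl fun k _ => ?_
      rw [integral_const_mul, ← h2 τ hτ _ (hk k).le, laplaceExponent]
  have hsum : ContinuousOn (fun τ => ∑ k ∈ p.support, p.coeff k / ((k + 1) * β) * P k τ) (Ici 0) :=
    continuousOn_finsetSum _ fun k _ => continuousOn_const.mul (hPc k)
  refine ⟨hsum.congr fun τ hτ => hpair τ hτ, fun t ht => ?_⟩
  have hPi : ∀ k, IntervalIntegrable (P k) volume 0 t := fun k =>
    ((hPc k).mono (by rw [uIcc_of_le ht]; exact Icc_subset_Ici_self)).intervalIntegrable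
  rw [hint t ht, hint 0 le_rfl, intervalIntegral.integral_congr (g := fun τ =>
    ∑ k ∈ p.support, p.coeff k / ((k + 1) * β) * P k τ)
    (fun τ hτ => hpair τ (by rw [uIcc_of_le ht] at hτ; exact hτ.1)),
    intervalIntegral.integral_finsetSum fun k _ => (hPi k).const_mul _, ← Finset.sum_add_distrib]
  refine Finset.sum_congr rfl fun k _ => ?_
  rw [intervalIntegral.integral_const_mul, evolvedExponent_sub h ht (hk k),
    evolvedExponent_zero h (hk k).le, mul_add]

/-- The weak equation for exponential sums extends to all test functions. -/
lemma isTestFunction_weak_eq (h : firstMoment ν₀ < ⊤)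
    (h1 : ∀ t, 0 ≤ t → firstMoment (ν t) = firstMoment ν₀)
    (h2 : ∀ t, 0 ≤ t → ∀ s, 0 ≤ s → laplaceExponent (ν t) s = evolvedExponent ν₀ t s)
    {f : ℝ → ℝ} (hf : IsTestFunction 1 f) :
    ContinuousOn (fun τ => coagPairing additiveKernel f (ν τ)) (Ici 0) ∧
      ∀ t, 0 ≤ t → ∫ x : E, f x ∂(ν t) = (∫ x : E, f x ∂(ν 0)) +
        ∫ τ in (0 : ℝ)..t, coagPairing additiveKernel f (ν τ) := by
  obtain ⟨C, hC⟩ := hf.exists_isLipschitzVanishing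
  have hfin : ∀ t, 0 ≤ t → firstMoment (ν t) < ⊤ := fun t ht => h1 t ht ▸ h
  have hmass : ∀ t, 0 ≤ t → mass (ν t) = mass ν₀ := fun t ht =>
    mass_eq_of_firstMoment_eq h (h1 t ht)
  -- Exponential sums approximate `f` with errors uniform in time, because the mass is the same at
  -- all times.
  have happ : ∀ ε, 0 < ε → ∃ g : ℝ → ℝ,
      (ContinuousOn (fun τ => coagPairing additiveKernel g (ν τ)) (Ici 0) ∧
      ∀ t, 0 ≤ t → ∫ x : E, g x ∂(ν t) = (∫ x : E, g x ∂(ν 0)) +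
        ∫ τ in (0 : ℝ)..t, coagPairing additiveKernel g (ν τ)) ∧
      (∀ t, 0 ≤ t → |∫ x : E, f x ∂(ν t) - ∫ x : E, g x ∂(ν t)| ≤ ε * mass ν₀) ∧
      ∀ t, 0 ≤ t → |coagPairing additiveKernel f (ν t) - coagPairing additiveKernel g (ν t)| ≤
        2 * ε * mass ν₀ ^ 2 := fun ε hε => by
    obtain ⟨β, hβ, p, hp⟩ := hf.exists_expSum hε
    have hg : IsLipschitzVanishing (C + ε) (expSum β p) := by
      refine ⟨fun x hx => ?_, fun x y hx hy => ?_⟩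
      · have e : expSum β p x = f x - (f x - expSum β p x) := by ring
        rw [e]
        refine (abs_sub _ _).trans ?_
        linarith [hC.1 x hx, hp.1 x hx]
      · have e : expSum β p x - expSum β p y =
            (f x - f y) - ((f x - expSum β p x) - (f y - expSum β p y)) := by ring
        rw [e]
        refine (abs_sub _ _).trans ?_
        linarith [hC.2 x y hx hy, hp.2 x y hx hy]
    refine ⟨expSum β p, expSum_weak_eq h h1 h2 hβ p, fun t ht => ?_, fun t ht => ?_⟩
    · rw [← integral_sub (hC.integrable (hfin t ht)) (hg.integrable (hfin t ht)), ← hmass t ht]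
      exact hp.abs_integral_le (hfin t ht)
    · have := isFiniteMeasureOnCompacts_of_firstMoment (hfin t ht)
      have := sigmaFinite_of_isFiniteMeasureOnCompacts (ν t)
      rw [← hC.coagPairing_sub hg (hfin t ht), ← hmass t ht]
      exact hp.abs_coagPairing_le (hfin t ht)
  have hcont : ContinuousOn (fun τ => coagPairing additiveKernel f (ν τ)) (Ici 0) := by
    refine continuousOn_of_uniform_approx_of_continuousOn fun u hu => ?_
    obtain ⟨δ, hδ, hu⟩ := Metric.mem_uniformity_dist.1 hu
    -- The added `1` covers vanishing mass.
    have hden : 0 < 2 * mass ν₀ ^ 2 + 1 := by positivity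
    obtain ⟨g, ⟨hgc, -⟩, -, hgp⟩ := happ (δ / (2 * mass ν₀ ^ 2 + 1)) (by positivity)
    refine ⟨_, hgc, fun τ hτ => hu ?_⟩
    rw [Real.dist_eq]
    refine (hgp τ hτ).trans_lt ?_
    have : 2 * (δ / (2 * mass ν₀ ^ 2 + 1)) * mass ν₀ ^ 2 =
        δ * ((2 * mass ν₀ ^ 2) / (2 * mass ν₀ ^ 2 + 1)) := by ring
    rw [this]
    exact mul_lt_of_lt_one_right hδ ((div_lt_one hden).2 (by linarith))
  refine ⟨hcont, fun t ht => ?_⟩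
  have hii : ∀ {P : ℝ → ℝ}, ContinuousOn P (Ici 0) → IntervalIntegrable P volume 0 t := fun hP =>
    (hP.mono (by rw [uIcc_of_le ht]; exact Icc_subset_Ici_self)).intervalIntegrable
  have hle : ∀ ε, 0 < ε → |∫ x : E, f x ∂(ν t) - ((∫ x : E, f x ∂(ν 0)) +
      ∫ τ in (0 : ℝ)..t, coagPairing additiveKernel f (ν τ))| ≤
      ε * (2 * mass ν₀ + 2 * mass ν₀ ^ 2 * t) := fun ε hε => by
    obtain ⟨g, ⟨hgc, hgw⟩, hgi, hgp⟩ := happ ε hε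
    have e1 := abs_le.1 (hgi t ht)
    have e2 := abs_le.1 (hgi 0 le_rfl)
    have e3 : |(∫ τ in (0 : ℝ)..t, coagPairing additiveKernel f (ν τ)) -
        ∫ τ in (0 : ℝ)..t, coagPairing additiveKernel g (ν τ)| ≤ 2 * ε * mass ν₀ ^ 2 * |t - 0| := by
      rw [← intervalIntegral.integral_sub (hii hcont) (hii hgc)]
      refine intervalIntegral.norm_integral_le_of_norm_le_const
        (f := fun τ => coagPairing additiveKernel f (ν τ) - coagPairing additiveKernel g (ν τ))
        fun τ hτ => hgp τ ?_
      rw [uIoc_of_le ht] at hτ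
      exact hτ.1.le
    rw [sub_zero, abs_of_nonneg ht] at e3
    have e3 := abs_le.1 e3
    have := hgw t ht
    rw [abs_le]
    constructor <;> linarith
  have hlim : Tendsto (fun ε : ℝ => ε * (2 * mass ν₀ + 2 * mass ν₀ ^ 2 * t)) (𝓝[>] 0) (𝓝 0) := by
    have : Continuous fun ε : ℝ => ε * (2 * mass ν₀ + 2 * mass ν₀ ^ 2 * t) := by fun_prop
    exact (this.tendsto' 0 0 (by simp)).mono_left nhdsWithin_le_nhds
  exact sub_eq_zero.1 (abs_nonpos_iff.1
    (ge_of_tendsto hlim (eventually_nhdsWithin_of_forall fun ε hε => hle ε hε)))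

theorem isAdditiveSolution_of_evolved (h : firstMoment ν₀ < ⊤)
    (h1 : ∀ t, 0 ≤ t → firstMoment (ν t) = firstMoment ν₀)
    (h2 : ∀ t, 0 ≤ t → ∀ s, 0 ≤ s → laplaceExponent (ν t) s = evolvedExponent ν₀ t s) :
    IsAdditiveSolution ν := by
  have hfin : ∀ t, 0 ≤ t → firstMoment (ν t) < ⊤ := fun t ht => h1 t ht ▸ h
  have hii : ∀ f, IsTestFunction 1 f → ∀ t, 0 ≤ t →
      IntervalIntegrable (fun τ => coagPairing additiveKernel f (ν τ)) volume 0 t :=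
    fun f hf t ht => ((isTestFunction_weak_eq h h1 h2 hf).1.mono
      (by rw [uIcc_of_le ht]; exact Icc_subset_Ici_self)).intervalIntegrable
  refine ⟨fun t ht => isFiniteMeasureOnCompacts_of_firstMoment (hfin t ht), hfin 0 le_rfl, ?_, ?_,
    ?_, hii, fun f hf => (isTestFunction_weak_eq h h1 h2 hf).2⟩
  · intro B hB
    obtain ⟨F, hF, hlim⟩ := exists_isTestFunction_tendsto_indicator hB
    refine measurable_of_tendsto_metrizable (fun n => ?_)
      (tendsto_pi_nhds.2 fun t : Ici (0 : ℝ) => hlim (ν t) (hfin t t.2))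
    have hc := continuousOn_of_eq_primitive (F := fun t => ∫ x : E, F n x ∂(ν t)) (hii _ (hF n))
      (isTestFunction_weak_eq h h1 h2 (hF n)).2
    exact (hc.comp_continuous continuous_subtype_val fun t => t.2).measurable.ennreal_ofReal
  · intro t _
    rw [setLIntegral_congr_fun (g := fun _ => firstMoment ν₀ ^ 2) measurableSet_Ioc
      fun τ hτ => by rw [h1 τ hτ.1.le], setLIntegral_const]
    exact ENNReal.mul_lt_top (ENNReal.pow_lt_top h) (by simp)
  · intro f hf t ht
    obtain ⟨C, hC⟩ := hf.exists_isLipschitzVanishing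
    exact hC.integrable (hfin t ht)

end

/-- Existence of a solution with the evolved Laplace exponents. -/
theorem exists_isAdditiveSolution {ν₀ : Measure E} (h : firstMoment ν₀ < ⊤) :
    ∃ ν : ℝ → Measure E, IsAdditiveSolution ν ∧ ν 0 = ν₀ ∧
      (∀ t, 0 ≤ t → firstMoment (ν t) = firstMoment ν₀) ∧
      ∀ t, 0 ≤ t → ∀ s, 0 ≤ s → laplaceExponent (ν t) s = evolvedExponent ν₀ t s := by
  -- At time zero `ν₀` itself is prescribed, so the initial condition is an equality of measures;
  -- negative times get the zero measure.
  have hex : ∀ t : ℝ, ∃ μ : Measure E, (t = 0 → μ = ν₀) ∧ (0 ≤ t →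
      firstMoment μ = firstMoment ν₀ ∧
        ∀ s, 0 ≤ s → laplaceExponent μ s = evolvedExponent ν₀ t s) := fun t => by
    rcases eq_or_ne t 0 with rfl | ht0
    · exact ⟨ν₀, fun _ => rfl, fun _ => ⟨rfl, fun s hs => (evolvedExponent_zero h hs).symm⟩⟩
    · rcases le_or_gt 0 t with ht | ht
      · obtain ⟨μ, hμ⟩ := exists_measure_evolvedExponent h ht
        exact ⟨μ, fun h0 => absurd h0 ht0, fun _ => hμ⟩
      · exact ⟨0, fun h0 => absurd h0 ht0, fun h0 => absurd h0 (not_le.2 ht)⟩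
  choose ν hν0 hν using hex
  exact ⟨ν, isAdditiveSolution_of_evolved h (fun t ht => (hν t ht).1) fun t ht => (hν t ht).2,
    hν0 0 rfl, fun t ht => (hν t ht).1, fun t ht => (hν t ht).2⟩

/-! ### Uniqueness -/

/-- Half of the decay absorbs the linear factor. -/
lemma exp_neg_le_exp_neg_half (s x : ℝ) :
    (1 + s * x) * Real.exp (-(s * x)) ≤ 2 * Real.exp (-(s / 2) * x) := by
  have h1 := Real.add_one_le_exp (s / 2 * x)
  have h2 : Real.exp (-(s / 2) * x) = Real.exp (s / 2 * x) * Real.exp (-(s * x)) := by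
    rw [← Real.exp_add]; congr 1; ring
  have h3 : 1 + s * x ≤ 2 * Real.exp (s / 2 * x) := by linarith
  rw [h2, ← mul_assoc]
  exact mul_le_mul_of_nonneg_right h3 (Real.exp_pos _).le

lemma tendsto_exp_neg_mul_atTop {s : ℝ} (hs : 0 < s) :
    Tendsto (fun x : ℝ => Real.exp (-(s * x))) atTop (𝓝 0) :=
  Real.tendsto_exp_neg_atTop_nhds_zero.comp (tendsto_id.const_mul_atTop hs)

lemma isTestFunction_one_sub_exp {s : ℝ} (hs : 0 < s) :
    IsTestFunction 1 fun x => 1 - Real.exp (-(s * x)) := by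
  have hc : Continuous fun x : ℝ => 1 - Real.exp (-(s * x)) := by fun_prop
  have hc' : Continuous fun x : ℝ => s * Real.exp (-(s * x)) := by fun_prop
  refine isTestFunction_of_hasDerivAt (fun x _ => hasDerivAt_one_sub_exp s x) hc'.continuousOn
    ((hc.tendsto' 0 0 (by simp)).mono_left nhdsWithin_le_nhds)
    ⟨1 - 0, (tendsto_exp_neg_mul_atTop hs).const_sub 1⟩
    ⟨_, (hc'.tendsto 0).mono_left nhdsWithin_le_nhds⟩ ⟨s, s, hs, fun x _ => ?_⟩
  rw [abs_of_nonneg (by positivity), neg_mul]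

/-- Makes `massTransform` the integral of a test function, hence continuous in time for every
solution. -/
lemma isTestFunction_mul_exp {s : ℝ} (hs : 0 < s) :
    IsTestFunction 1 fun x => x * Real.exp (-(s * x)) := by
  have hc : Continuous fun x : ℝ => x * Real.exp (-(s * x)) := by fun_prop
  have hc' : Continuous fun x : ℝ => (1 - s * x) * Real.exp (-(s * x)) := by fun_prop
  refine isTestFunction_of_hasDerivAt (f' := fun x => (1 - s * x) * Real.exp (-(s * x)))
    (fun x _ => ?_) hc'.continuousOn
    ((hc.tendsto' 0 0 (by simp)).mono_left nhdsWithin_le_nhds) ⟨0, ?_⟩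
    ⟨_, (hc'.tendsto 0).mono_left nhdsWithin_le_nhds⟩ ⟨2, s / 2, half_pos hs, fun x hx => ?_⟩
  · have h1 : HasDerivAt (fun x : ℝ => -(s * x)) (-(s * 1)) x :=
      ((hasDerivAt_id _).const_mul _).neg
    exact ((hasDerivAt_id x).mul h1.exp).congr_deriv (by simp; ring)
  · have h1 := ((tendsto_exp_neg_mul_atTop (half_pos hs)).const_mul (2 / s))
    rw [mul_zero] at h1
    refine squeeze_zero' ((eventually_ge_atTop 0).mono fun x hx => by positivity)
      ((eventually_ge_atTop 0).mono fun x hx => ?_) h1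
    have h2 := exp_neg_le_exp_neg_half s x
    rw [neg_mul] at h2
    rw [div_mul_eq_mul_div, le_div_iff₀ hs]
    linarith [Real.exp_pos (-(s * x))]
  · have hsx := mul_pos hs hx
    rw [abs_mul, abs_of_pos (Real.exp_pos _)]
    refine le_trans (mul_le_mul_of_nonneg_right ?_ (Real.exp_pos _).le)
      (exp_neg_le_exp_neg_half s x)
    rw [abs_le]
    constructor <;> linarith

/-- Chain rule along a curve: `φ` has a partial derivative in time along the first variable at the
point, and a jointly continuous partial derivative `M` in the second variable. -/
lemma hasDerivWithinAt_along_curve {φ M : ℝ → ℝ → ℝ} {σ : ℝ → ℝ} {σ' d t : ℝ} {S : Set ℝ}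
    (hφt : HasDerivWithinAt (fun τ => φ τ (σ t)) d S t) (hσ : HasDerivAt σ σ' t)
    (hφs : ∀ᶠ p : ℝ × ℝ in 𝓝[S] t ×ˢ 𝓝 (σ t), HasDerivAt (φ p.1) (M p.1 p.2) p.2)
    (hM : Tendsto (fun p : ℝ × ℝ => M p.1 p.2) (𝓝[S] t ×ˢ 𝓝 (σ t)) (𝓝 (M t (σ t)))) :
    HasDerivWithinAt (fun τ => φ τ (σ τ)) (d + M t (σ t) * σ') S t := by
  have h1 : (fun τ => φ τ (σ τ) - φ τ (σ t) - M t (σ t) * (σ τ - σ t)) =o[𝓝[S] t]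
      fun τ => σ τ - σ t := by
    refine Asymptotics.isLittleO_iff.2 fun c hc => ?_
    obtain ⟨A, hA, B, hB, hAB⟩ := eventually_prod_iff.1
      (hφs.and (hM.eventually (Metric.closedBall_mem_nhds _ hc)))
    obtain ⟨δ, hδ, hδB⟩ := Metric.eventually_nhds_iff_ball.1 hB
    filter_upwards [hA, (hσ.continuousAt.tendsto.mono_left nhdsWithin_le_nhds).eventually
      (Metric.ball_mem_nhds _ hδ)] with τ hτ hτδ
    -- Mean value inequality on the slice at time `τ`, after subtracting the linear part at `(t, σ
    -- t)`; this way the time derivative is needed only at the fixed point `σ t`.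
    have h := (convex_ball (σ t) δ).norm_image_sub_le_of_norm_hasDerivWithin_le
      (f := fun z => φ τ z - M t (σ t) * z) (f' := fun z => M τ z - M t (σ t)) (C := c)
      (fun z hz => ((hAB hτ (hδB z hz)).1.sub
        (((hasDerivAt_id z).const_mul _).congr_deriv (mul_one _))).hasDerivWithinAt)
      (fun z hz => (hAB hτ (hδB z hz)).2) (Metric.mem_ball_self hδ) hτδ
    refine (congrArg norm ?_).trans_le h
    ring
  have h2 : (fun τ => σ τ - σ t) =O[𝓝[S] t] fun τ => τ - t :=
    (hσ.differentiableAt.isBigO_sub).mono nhdsWithin_le_nhds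
  have h3 := h1.trans_isBigO h2
  have h4 := (hasDerivWithinAt_iff_isLittleO.1 (hσ.hasDerivWithinAt (s := S))).const_mul_left
    (M t (σ t))
  have h5 := hasDerivWithinAt_iff_isLittleO.1 hφt
  rw [hasDerivWithinAt_iff_isLittleO]
  refine ((h3.add h4).add h5).congr_left fun τ => ?_
  simp only [smul_eq_mul]
  ring

namespace IsAdditiveSolution

variable {ν : ℝ → Measure E}

lemma continuousOn_integral (hν : IsAdditiveSolution ν) {f : ℝ → ℝ} (hf : IsTestFunction 1 f) :
    ContinuousOn (fun t => ∫ x : E, f x ∂(ν t)) (Ici 0) :=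
  continuousOn_of_eq_primitive (hν.intervalIntegrable f hf) (hν.weak_eq f hf)

lemma continuousOn_laplaceExponent (hν : IsAdditiveSolution ν) {s : ℝ} (hs : 0 < s) :
    ContinuousOn (fun t => laplaceExponent (ν t) s) (Ici 0) :=
  hν.continuousOn_integral (isTestFunction_one_sub_exp hs)

lemma continuousOn_massTransform (hν : IsAdditiveSolution ν) {s : ℝ} (hs : 0 < s) :
    ContinuousOn (fun t => massTransform (ν t) s) (Ici 0) :=
  hν.continuousOn_integral (isTestFunction_mul_exp hs)

lemma tendsto_firstMoment (hν : IsAdditiveSolution ν) {t : ℝ} (ht : 0 ≤ t) :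
    Tendsto (fun n : ℕ => ENNReal.ofReal ((n + 1 : ℝ) * laplaceExponent (ν t) (1 / (n + 1 : ℝ))))
      atTop (𝓝 (firstMoment (ν t))) :=
  tendsto_ofReal_mul_laplaceExponent fun _ hs =>
    hν.integrable _ (isTestFunction_one_sub_exp hs) t ht

lemma aemeasurable_firstMoment (hν : IsAdditiveSolution ν) (t : ℝ) :
    AEMeasurable (fun τ => firstMoment (ν τ)) (volume.restrict (Ioc 0 t)) := by
  refine aemeasurable_of_tendsto_metrizable_ae atTop (f := fun (n : ℕ) τ =>
    ENNReal.ofReal ((n + 1 : ℝ) * laplaceExponent (ν τ) (1 / (n + 1 : ℝ)))) (fun n => ?_) ?_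
  · have h1 := (hν.continuousOn_laplaceExponent (s := 1 / (n + 1 : ℝ)) (by positivity)).mono
      (show Ioc 0 t ⊆ Ici 0 from fun τ hτ => hτ.1.le)
    exact ((h1.aemeasurable measurableSet_Ioc).const_mul _).ennreal_ofReal
  · exact (ae_restrict_mem measurableSet_Ioc).mono fun τ hτ => hν.tendsto_firstMoment hτ.1.le

lemma ae_firstMoment_lt_top (hν : IsAdditiveSolution ν) {t : ℝ} (ht : 0 < t) :
    ∀ᵐ τ ∂volume.restrict (Ioc 0 t), firstMoment (ν τ) < ⊤ := by
  filter_upwards [ae_lt_top' ((hν.aemeasurable_firstMoment t).pow_const 2) (hν.sq_mass t ht).ne]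
    with τ hτ
  exact lt_top_iff_ne_top.2 fun h => by simp [h] at hτ

lemma coagPairing_one_sub_exp (hν : IsAdditiveSolution ν) {s t : ℝ} (ht : 0 ≤ t)
    (hfin : firstMoment (ν t) < ⊤) (hs : 0 ≤ s) :
    coagPairing additiveKernel (fun x => 1 - Real.exp (-(s * x))) (ν t) =
      -(laplaceExponent (ν t) s * (mass (ν t) - massTransform (ν t) s)) := by
  have := hν.radon t ht
  have := sigmaFinite_of_isFiniteMeasureOnCompacts (ν t)
  exact Smoluchowski.coagPairing_one_sub_exp hfin hs

/-- Every solution conserves mass. -/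
theorem firstMoment_eq (hν : IsAdditiveSolution ν) {t : ℝ} (ht : 0 ≤ t) :
    firstMoment (ν t) = firstMoment (ν 0) := by
  rcases ht.eq_or_lt with rfl | ht0
  · rfl
  let e : ℕ → ℝ → ℝ := fun n x => 1 - Real.exp (-(1 / (n + 1 : ℝ) * x))
  have he : ∀ n, IsTestFunction 1 (e n) := fun n => isTestFunction_one_sub_exp (by positivity)
  -- The functions `(n+1) e n` increase to `x`. Their pairings are `-(n+1) φ(s)(m - φ'(s))` at `s =
  -- 1/(n+1)`, with `m` the mass at time `τ`; they are dominated by `m²`, integrable by `sq_mass`,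
  -- and tend to `-m(m - m) = 0`.
  have hlim : Tendsto (fun n : ℕ => ∫ τ in (0 : ℝ)..t,
      (n + 1 : ℝ) * coagPairing additiveKernel (e n) (ν τ)) atTop
      (𝓝 (∫ _τ in (0 : ℝ)..t, (0 : ℝ))) := by
    refine intervalIntegral.tendsto_integral_filter_of_dominated_convergence
      (fun τ => (firstMoment (ν τ) ^ 2).toReal) (Eventually.of_forall fun n => ?_)
      (Eventually.of_forall fun n => ?_) ?_ ?_
    · rw [uIoc_of_le ht]
      exact ((hν.intervalIntegrable _ (he n) t ht).1.const_mul _).aestronglyMeasurable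
    · rw [← ae_restrict_iff' measurableSet_uIoc, uIoc_of_le ht]
      filter_upwards [hν.ae_firstMoment_lt_top ht0, ae_restrict_mem measurableSet_Ioc] with τ hf hτ
      have hs : (0 : ℝ) ≤ 1 / (n + 1) := by positivity
      have hn : (0 : ℝ) < n + 1 := by positivity
      have a1 := laplaceExponent_nonneg (ν := ν τ) hs
      have a2 := laplaceExponent_le hf hs
      have a3 := massTransform_nonneg (ν := ν τ) (1 / (n + 1))
      have a4 := massTransform_le_mass hf hs
      have a5 : (n + 1 : ℝ) * laplaceExponent (ν τ) (1 / (n + 1)) ≤ mass (ν τ) := by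
        rw [mul_one_div, le_div_iff₀ hn] at a2
        linarith
      rw [hν.coagPairing_one_sub_exp hτ.1.le hf hs, ENNReal.toReal_pow,
        firstMoment_eq_ofReal_mass hf, ENNReal.toReal_ofReal (mass_nonneg _), mul_neg, norm_neg,
        ← mul_assoc, Real.norm_of_nonneg (mul_nonneg (by positivity) (sub_nonneg.2 a4)), sq]
      exact mul_le_mul a5 (by linarith) (sub_nonneg.2 a4) (mass_nonneg _)
    · rw [intervalIntegrable_iff_integrableOn_Ioc_of_le ht]
      exact integrable_toReal_of_lintegral_ne_top ((hν.aemeasurable_firstMoment t).pow_const 2)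
        (hν.sq_mass t ht0).ne
    · rw [← ae_restrict_iff' measurableSet_uIoc, uIoc_of_le ht]
      filter_upwards [hν.ae_firstMoment_lt_top ht0, ae_restrict_mem measurableSet_Ioc] with τ hf hτ
      have h1 : Tendsto (fun n : ℕ => 1 / (n + 1 : ℝ)) atTop (𝓝[≥] 0) :=
        tendsto_nhdsWithin_iff.2 ⟨tendsto_one_div_add_atTop_nhds_zero_nat,
          Eventually.of_forall fun n => mem_Ici.2 (by positivity)⟩
      have h2 := ((tendsto_massTransform_zero hf).comp h1).const_sub (mass (ν τ))
      have h3 := ((tendsto_mul_laplaceExponent hf).mul h2).neg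
      rw [sub_self, mul_zero, neg_zero] at h3
      refine h3.congr fun n => ?_
      rw [hν.coagPairing_one_sub_exp hτ.1.le hf (by positivity)]
      simp only [Function.comp]
      ring
  rw [intervalIntegral.integral_zero] at hlim
  have h0 := (tendsto_mul_laplaceExponent hν.initial_mass).add hlim
  rw [add_zero] at h0
  -- The comparison takes place in `[0,∞]`, since the mass is known to be finite only at almost
  -- every time so far.
  refine tendsto_nhds_unique (hν.tendsto_firstMoment ht) ?_
  rw [firstMoment_eq_ofReal_mass hν.initial_mass]
  refine ((ENNReal.continuous_ofReal.tendsto _).comp h0).congr fun n => ?_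
  have h1 : laplaceExponent (ν t) (1 / (n + 1 : ℝ)) = laplaceExponent (ν 0) (1 / (n + 1 : ℝ)) +
    ∫ τ in (0 : ℝ)..t, coagPairing additiveKernel (e n) (ν τ) := hν.weak_eq _ (he n) t ht
  rw [Function.comp_apply, h1, intervalIntegral.integral_const_mul, mul_add]

/-- Along the characteristics the Laplace exponent of a solution decays exponentially. -/
lemma laplaceExponent_along_characteristic (hν : IsAdditiveSolution ν) {s₀ : ℝ} (hs₀ : 0 < s₀)
    {t : ℝ} (ht : 0 ≤ t) :
    laplaceExponent (ν t) (s₀ - laplaceExponent (ν 0) s₀ * timeChange (mass (ν 0)) t) =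
      Real.exp (-(mass (ν 0) * t)) * laplaceExponent (ν 0) s₀ := by
  set m := mass (ν 0)
  set p := laplaceExponent (ν 0) s₀
  have hfin : ∀ τ, 0 ≤ τ → firstMoment (ν τ) < ⊤ := fun τ hτ =>
    hν.firstMoment_eq hτ ▸ hν.initial_mass
  have hmass : ∀ τ, 0 ≤ τ → mass (ν τ) = m := fun τ hτ =>
    mass_eq_of_firstMoment_eq hν.initial_mass (hν.firstMoment_eq hτ)
  -- The characteristic is written with the predicted value `p e^{-mτ}` as its speed. It stays
  -- positive since `p ≤ m s₀` and `θm < 1`.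
  let σ : ℝ → ℝ := fun τ => s₀ - p * timeChange m τ
  have hσpos : ∀ τ, 0 ≤ τ → 0 < σ τ := fun τ hτ => by
    have h1 := mul_le_mul_of_nonneg_right (laplaceExponent_le hν.initial_mass hs₀.le)
      (timeChange_nonneg m hτ)
    have h2 := mul_pos hs₀ (sub_pos.2 (timeChange_mul_lt m τ))
    simp only [σ]
    linarith
  have hσ : ∀ τ, HasDerivAt σ (-(p * Real.exp (-(m * τ)))) τ := fun τ =>
    ((hasDerivAt_timeChange m τ).const_mul p).const_sub s₀
  have hexp : ∀ τ, HasDerivAt (fun τ => Real.exp (-(m * τ)) * p)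
      (-(m * Real.exp (-(m * τ))) * p) τ := fun τ => by
    have h1 : HasDerivAt (fun τ : ℝ => -(m * τ)) (-(m * 1)) τ :=
      ((hasDerivAt_id _).const_mul _).neg
    exact (h1.exp.mul_const p).congr_deriv (by ring)
  -- The defect from the predicted value obeys the homogeneous linear equation `g' = (φ' - m) g`
  -- with `g(0) = 0` and `|φ' - m| ≤ m`, so Gronwall gives `g = 0`.
  let g : ℝ → ℝ := fun τ => laplaceExponent (ν τ) (σ τ) - Real.exp (-(m * τ)) * p
  have hg : ∀ τ, 0 ≤ τ → HasDerivWithinAt g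
      ((massTransform (ν τ) (σ τ) - m) * g τ) (Ici 0) τ := fun τ hτ => by
    have hr : 0 < σ τ / 2 := half_pos (hσpos τ hτ)
    have hnear : ∀ᶠ q : ℝ × ℝ in 𝓝[Ici 0] τ ×ˢ 𝓝 (σ τ), 0 ≤ q.1 ∧ σ τ / 2 < q.2 :=
      (eventually_mem_nhdsWithin (s := Ici 0)).prod_mk
        (eventually_gt_nhds (half_lt_self (hσpos τ hτ)))
    have hpair : ∀ r, 0 ≤ r →
        coagPairing additiveKernel (fun x => 1 - Real.exp (-(σ τ * x))) (ν r) =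
          -(laplaceExponent (ν r) (σ τ) * (m - massTransform (ν r) (σ τ))) := fun r hr0 => by
      rw [hν.coagPairing_one_sub_exp hr0 (hfin r hr0) (hσpos τ hτ).le, hmass r hr0]
    have hφt : HasDerivWithinAt (fun r => laplaceExponent (ν r) (σ τ))
        (-(laplaceExponent (ν τ) (σ τ) * (m - massTransform (ν τ) (σ τ)))) (Ici 0) τ := by
      refine hasDerivWithinAt_of_eq_primitive (P := fun r =>
        -(laplaceExponent (ν r) (σ τ) * (m - massTransform (ν r) (σ τ))))
        ((hν.continuousOn_laplaceExponent (hσpos τ hτ)).mul (continuousOn_const.sub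
          (hν.continuousOn_massTransform (hσpos τ hτ)))).neg (fun r hr0 => ?_) hτ
      refine (hν.weak_eq _ (isTestFunction_one_sub_exp (hσpos τ hτ)) r hr0).trans ?_
      rw [intervalIntegral.integral_congr fun z hz =>
        hpair z (by rw [uIcc_of_le hr0] at hz; exact hz.1)]
      rfl
    -- Joint continuity splits into a Lipschitz bound in `s`, uniform in time by mass conservation,
    -- and continuity in time at the fixed point `σ τ`.
    have hM : Tendsto (fun q : ℝ × ℝ => massTransform (ν q.1) q.2) (𝓝[Ici 0] τ ×ˢ 𝓝 (σ τ))
        (𝓝 (massTransform (ν τ) (σ τ))) := by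
      rw [tendsto_iff_dist_tendsto_zero]
      have c1 : Tendsto (fun q : ℝ × ℝ => m / (σ τ / 2) * |q.2 - σ τ|)
          (𝓝[Ici 0] τ ×ˢ 𝓝 (σ τ)) (𝓝 0) := by
        have : Continuous fun z : ℝ => m / (σ τ / 2) * |z - σ τ| := by fun_prop
        exact (this.tendsto' (σ τ) 0 (by simp)).comp tendsto_snd
      have c2 : Tendsto (fun q : ℝ × ℝ => |massTransform (ν q.1) (σ τ) -
          massTransform (ν τ) (σ τ)|) (𝓝[Ici 0] τ ×ˢ 𝓝 (σ τ)) (𝓝 0) := by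
        have := tendsto_iff_dist_tendsto_zero.1
          ((hν.continuousOn_massTransform (hσpos τ hτ)) τ hτ).tendsto
        exact this.comp tendsto_fst
      have c3 := c1.add c2
      rw [add_zero] at c3
      refine squeeze_zero' (Eventually.of_forall fun _ => dist_nonneg) ?_ c3
      filter_upwards [hnear] with q hq
      rw [Real.dist_eq]
      refine (abs_sub_le _ (massTransform (ν q.1) (σ τ)) _).trans (add_le_add ?_ le_rfl)
      rw [← hmass q.1 hq.1]
      exact abs_massTransform_sub_le (hfin q.1 hq.1) hr (half_le_self (hσpos τ hτ).le) hq.2.le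
    have hcurve := hasDerivWithinAt_along_curve (φ := fun r s => laplaceExponent (ν r) s)
      (M := fun r s => massTransform (ν r) s) hφt (hσ τ)
      (hnear.mono fun q hq => hasDerivAt_laplaceExponent (hfin q.1 hq.1) (hr.trans hq.2)) hM
    exact (hcurve.sub (hexp τ).hasDerivWithinAt).congr_deriv (by simp only [g]; ring)
  have hzero := eq_zero_of_abs_deriv_le_mul_abs_self_of_eq_zero_right (f := g)
    (f' := fun τ => (massTransform (ν τ) (σ τ) - m) * g τ) (K := m) (a := 0) (b := t)
    (fun τ hτ => ((hg τ hτ.1).continuousWithinAt).mono Icc_subset_Ici_self)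
    (fun τ hτ => (hg τ hτ.1).mono (Ici_subset_Ici.2 hτ.1))
    (by simp [g, σ, timeChange_zero, p])
    (fun τ hτ => by
      rw [norm_mul]
      refine mul_le_mul_of_nonneg_right ?_ (norm_nonneg _)
      have a1 := massTransform_nonneg (ν := ν τ) (σ τ)
      have a2 := massTransform_le_mass (hfin τ hτ.1) (hσpos τ hτ.1).le
      rw [hmass τ hτ.1] at a2
      rw [Real.norm_eq_abs, abs_le]
      constructor <;> linarith) t ⟨ht, le_rfl⟩
  exact sub_eq_zero.1 hzero

/-- The Laplace exponents of a solution are determined by its initial value. -/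
theorem laplaceExponent_eq (hν : IsAdditiveSolution ν) {s t : ℝ} (hs : 0 < s) (ht : 0 ≤ t) :
    laplaceExponent (ν t) s = evolvedExponent (ν 0) t s := by
  have hθ := timeChange_nonneg (mass (ν 0)) ht
  have hθm := timeChange_mul_lt (mass (ν 0)) t
  have hroot := hs.trans_le (le_charRoot hν.initial_mass hθ hθm hs.le)
  have heq := charRoot_eq hν.initial_mass hθ hθm hs.le
  -- The characteristic started at the root arrives at `s` at time `t`; this is the characteristic
  -- equation read backwards.
  have h1 := hν.laplaceExponent_along_characteristic hroot ht
  have h2 : charRoot (ν 0) (timeChange (mass (ν 0)) t) s -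
      laplaceExponent (ν 0) (charRoot (ν 0) (timeChange (mass (ν 0)) t) s) *
        timeChange (mass (ν 0)) t = s := by linarith
  rwa [h2] at h1

end IsAdditiveSolution

end Smoluchowski

/-! ### Existence, mass conservation and uniqueness combined. -/

theorem mainTheorem4
    (ν₀ : MeasureTheory.Measure Smoluchowski.E)
    (hν₀ : MeasureTheory.IsFiniteMeasureOnCompacts ν₀)
    (hmass : Smoluchowski.firstMoment ν₀ < ⊤) :
    ∃ ν : ℝ → MeasureTheory.Measure Smoluchowski.E,
      Smoluchowski.IsAdditiveSolution ν ∧ ν 0 = ν₀ ∧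
      (∀ t, 0 ≤ t → Smoluchowski.firstMoment (ν t) = Smoluchowski.firstMoment ν₀) ∧
      ∀ ν' : ℝ → MeasureTheory.Measure Smoluchowski.E,
        Smoluchowski.IsAdditiveSolution ν' → ν' 0 = ν₀ → ∀ t, 0 ≤ t → ν' t = ν t := by
  obtain ⟨ν, hν, h0, hfm, hle⟩ := Smoluchowski.exists_isAdditiveSolution hmass
  refine ⟨ν, hν, h0, hfm, fun ν' hν' h0' t ht => ?_⟩
  refine Smoluchowski.ext_of_laplaceExponent_eq ?_ ?_ fun s hs => ?_
  · rw [hν'.firstMoment_eq ht, h0']; exact hmass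
  · rw [hfm t ht]; exact hmass
  · rw [hν'.laplaceExponent_eq hs ht, h0', hle t ht s hs.le]
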